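/- **Setting.** A Mealy machine over a finite input alphabet $\Sigma$ is $M=(Q,\Sigma,\Lambda,\delta,\gamma,s)$ with a finite set $Q$ of states, a start state $s\in Q$, a partial transition function $\delta:Q\times\Sigma\rightharpoonup Q$ and an output (cost) function $\gamma:Q\times\Sigma\to\Lambda$ with $\Lambda\subset[0,\infty)$ finite. A hierarchical Mealy machine $Z=(X,T)$ consists of a finite set $X$ of Mealy machines over $\Sigma$ and a rooted tree $T$ with node set $X$, in which every $M\in X$ has, for each $q\in Q(M)$, an outgoing arc labelled $q$ that leads either to a machine $M_q\in X$ or to nothing ($M_q=\emptyset$). **Algorithm (offline step).** Run the following recursive procedure on the root of $T$. For a machine $M\in X$: for every $q\in Q(M)$, put $c^q_x:=0$ for all $x\in\Sigma$ if $M_q=\emptyset$, and otherwise run the procedure on $M_q$ and put $c^q_x:=c^{M_q}_x$. Construct the augmented machine $\hat M$, with states $Q(M)\cup\{E_x\}_{x\in\Sigma}$, transitions $\hat\delta(q,x)=\delta(q,x)$ of cost $\hat\gamma(q,x)=c^q_x+\gamma(q,x)$ if $\delta(q,x)$ is defined, and $\hat\delta(q,x)=E_x$ of cost $\hat\gamma(q,x)=c^q_x$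 otherwise. Run Dijkstra's algorithm with a Fibonacci heap on $\hat M$ from $s(M)$ until all $E_x$ are settled or no reached state is left in the heap. Record, for every $x\in\Sigma$, the distance $c^M_x\in[0,\infty]$ of $E_x$ ($\infty$ if $E_x$ is not reached), and the trajectory $z^M_x$ of $\hat M$ found from $s(M)$ to $E_x$. **Statement.** Count as one step each reading or writing of a memory cell and each elementary operation (such as an addition or comparison of numbers, or a look-up of a value of $\delta$ or $\gamma$). There is a constant $C$ such that for every nonempty finite $\Sigma$ and every hierarchical Mealy machine $Z$ over $\Sigma$, the offline step terminates on $Z$ after at most $$C\,N\,\bigl[\,b_s|\Sigma|+(b_s+|\Sigma|)\log(b_s+|\Sigma|)\,\bigr]$$ steps, where $N=|X|$ is the number of machines of $Z$ and $b_s=\max_{M\in X}|Q(M)|$ is the maximal number of states of a machine of $Z$. -/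

import Mathlib

open scoped NNReal ENNReal

noncomputable section

namespace HiMM

/-! ### Mealy machines and hierarchical Mealy machines -/

/-- A Mealy machine over the input alphabet `A`, with non-negative real outputs (costs).
Its finite state set comes with a listing of its elements (`FinEnum`), as an algorithm that loops
over the states needs one; the listing is arbitrary. The transition function is partial: `none`
means that it is undefined. The output alphabet is the range of `γ`, which is finite since `Q` and
`A` are. -/
structure MealyMachine (A : Type) where
  /-- the states -/
  Q : Type
  [enumQ : FinEnum Q]
  /-- the partial transition function -/
  δ : Q → A → Option Q
  /-- the output function -/
  γ : Q → A → ℝ≥0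
  /-- the start state -/
  start : Q

attribute [instance] MealyMachine.enumQ

/-- A hierarchical Mealy machine `(X, T)`. The arc of `T` that leaves the machine `M` with the label
`q` goes to `child M q`, and `child M q = none` says that `q` is not refined, i.e. that `q` is a
state of the hierarchy. The last three fields say that these arcs form a tree with the given root
and with all of `X` as nodes. -/
structure Hierarchy (A : Type) where
  /-- the (indices of the) machines, which are the nodes of the tree -/
  X : Type
  [fintypeX : Fintype X]
  [decEqX : DecidableEq X]
  /-- the machines -/
  machine : X → MealyMachine A
  /-- the labelled arcs of the tree -/
  child : (M : X) → (machine M).Q → Option X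
  /-- the root machine -/
  root : X
  root_no_parent : ∀ (M : X) (q : (machine M).Q), child M q ≠ some root
  parent_unique : ∀ (Y : X) (a b : Sigma fun M : X => (machine M).Q),
    child a.1 a.2 = some Y → child b.1 b.2 = some Y → a = b
  reachable : ∀ Y : X, Relation.ReflTransGen (fun M M' => ∃ q, child M q = some M') root Y

attribute [instance] Hierarchy.fintypeX Hierarchy.decEqX

namespace Hierarchy

/-- The number of machines. -/
def numMachines {A : Type} (Z : Hierarchy A) : ℕ := Fintype.card Z.X

/-- The maximal number of states of a machine. -/
def maxStates {A : Type} (Z : Hierarchy A) : ℕ :=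
  Finset.univ.sup fun M : Z.X => FinEnum.card (Z.machine M).Q

end Hierarchy

/-! ### The cost model

A random access machine with unit costs: a program may read one memory cell, write one memory cell,
or perform one elementary operation (addition, comparison, increment or decrement, prepending
an element to a linked list, looking up an entry of the input) on values that it has already
fetched, and each of these is one step. Branching, calls and loop control only ever come together
with such a step: every round of a loop and every call of a procedure makes at least one.
-/

/-- A memory, together with the number of steps made so far. -/
structure Machine (S : Type) where
  mem : S
  steps : ℕ

/-- Programs that work on memories of type `S`. A program that does not terminate has the
value `none`. -/
abbrev Prog (S : Type) := StateT (Machine S) Option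

/-- One elementary operation on registers, whose result is `a`: one step. -/
def compute {S α : Type} (a : α) : Prog S α := fun m =>
  some (a, ⟨m.mem, m.steps + 1⟩)

/-- In a memory that consists of regions indexed by `X`, run a program in the region `i`. This is
an addressing convention: the number of steps is that of the program. -/
def inRegion {X : Type} [DecidableEq X] {S : X → Type} {α : Type} (i : X) (p : Prog (S i) α) :
    Prog ((j : X) → S j) α := fun m =>
  (p ⟨m.mem i, m.steps⟩).map fun r => (r.1, ⟨Function.update m.mem i r.2.mem, r.2.steps⟩)

/-! ### The memory used for one machine -/

/-- Whether a node of the graph has not been reached yet, is in the priority queue, or has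
left the queue with its final distance. -/
inductive Status
  | fresh
  | queued
  | settled
  deriving DecidableEq

/-- The states of the augmented machine: those of the machine, and the exit states `E x`. -/
abbrev Node (Q A : Type) := Q ⊕ A

/-- The exit state `E x`. -/
abbrev E {Q A : Type} (x : A) : Node Q A := Sum.inr x

/-- The memory cells for one machine with states `Q` and inputs `A`. -/
inductive Cell (Q A : Type)
  /-- the exit cost of the node `q` of the hierarchy with the input `x` -/
  | childCost (q : Q) (x : A)
  /-- the transition function of the augmented machine -/
  | deltaHat (q : Q) (x : A)
  /-- the output function of the augmented machine -/
  | gammaHat (q : Q) (x : A)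
  /-- the tentative distance of a node from the start; it is also its key in the heap -/
  | dist (v : Node Q A)
  /-- the last arc of the best path to `v` found so far: its source and its input -/
  | pred (v : Node Q A)
  | status (v : Node Q A)
  /-- the number of exit states not settled yet -/
  | exitsLeft
  /-- heap: the parent, `none` for a root -/
  | parent (v : Node Q A)
  /-- heap: the first element of the list of children of a node, and of the root list for `none` -/
  | first (p : Option (Node Q A))
  /-- heap: the next sibling -/
  | next (v : Node Q A)
  /-- heap: the previous sibling -/
  | prev (v : Node Q A)
  /-- heap: the number of children -/
  | degree (v : Node Q A)
  /-- heap: whether the node has lost a child since it became a child itself -/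
  | mark (v : Node Q A)
  /-- heap: the root with the least key -/
  | minRoot
  /-- heap: the auxiliary array, indexed by degrees, used for consolidating the root list -/
  | slot (d : ℕ)
  /-- output: the exit cost of the machine with the input `x` -/
  | exitCost (x : A)
  /-- output: the exit trajectory of the machine with the input `x` (a linked list) -/
  | exitTraj (x : A)
  deriving DecidableEq

/-- What the cells hold. -/
abbrev Cell.Val {Q A : Type} : Cell Q A → Type
  | childCost _ _ => ℝ≥0∞
  | deltaHat _ _ => Node Q A
  | gammaHat _ _ => ℝ≥0∞
  | dist _ => ℝ≥0∞
  | pred _ => Option (Q × A)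
  | status _ => Status
  | exitsLeft => ℕ
  | parent _ => Option (Node Q A)
  | first _ => Option (Node Q A)
  | next _ => Option (Node Q A)
  | prev _ => Option (Node Q A)
  | degree _ => ℕ
  | mark _ => Bool
  | minRoot => Option (Node Q A)
  | slot _ => Option (Node Q A)
  | exitCost _ => ℝ≥0∞
  | exitTraj _ => List (Q × A)

/-- The memory region of one machine. -/
abbrev Region (Q A : Type) := (c : Cell Q A) → c.Val

/-- Read the cell `c`: one step. -/
def read {Q A : Type} (c : Cell Q A) : Prog (Region Q A) c.Val := fun m =>
  some (m.mem c, ⟨m.mem, m.steps + 1⟩)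

/-- Write the cell `c`: one step. -/
def write {Q A : Type} [DecidableEq Q] [DecidableEq A] (c : Cell Q A) (a : c.Val) :
    Prog (Region Q A) Unit := fun m =>
  some ((), ⟨Function.update m.mem c a, m.steps + 1⟩)

section Local

variable {Q A : Type} [FinEnum Q] [FinEnum A]

/-! ### Fibonacci heaps

The lists of siblings are doubly linked. Keys are the entries of `dist`. -/

/-- Remove `v` from the list of its siblings. -/
def unlink (v : Node Q A) : Prog (Region Q A) Unit := do
  let p ← read (.parent v)
  let l ← read (.prev v)
  let r ← read (.next v)
  match l with
  | none => write (.first p) r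
  | some l => write (.next l) r
  match r with
  | none => pure ()
  | some r => write (.prev r) l

/-- Insert `v` at the front of the list of children of `p` (of the root list, if `p = none`). -/
def push (p : Option (Node Q A)) (v : Node Q A) : Prog (Region Q A) Unit := do
  let f ← read (.first p)
  write (.parent v) p
  write (.prev v) none
  write (.next v) f
  write (.first p) (some v)
  match f with
  | none => pure ()
  | some w => write (.prev w) (some v)

/-- Let the pointer to the minimum go to the root `v`, if its key is less. -/
def updateMin (v : Node Q A) : Prog (Region Q A) Unit := do
  let m ← read .minRoot
  match m with
  | none => write .minRoot (some v)
  | some u =>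
    let kv ← read (.dist v)
    let ku ← read (.dist u)
    let b ← compute (decide (kv < ku))
    if b then write .minRoot (some v) else pure ()

/-- Insert the new element `v`. -/
def insert (v : Node Q A) : Prog (Region Q A) Unit := do
  write (.first (some v)) none
  write (.degree v) (0 : ℕ)
  write (.mark v) false
  push none v
  updateMin v

/-- Make the root `y`, which has been taken out of the root list, a child of `x`. -/
def link (y x : Node Q A) : Prog (Region Q A) Unit := do
  push (some x) y
  write (.mark y) false
  let d ← read (.degree x)
  let d' ← compute ((d + 1 : ℕ))
  write (.degree x) d'

/-- Put the tree with root `x` into the slot for its degree; as long as that slot is occupied,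
link the two trees of equal degree. Returns the degree of the tree that is finally put down. -/
def place (x : Node Q A) : Prog (Region Q A) ℕ := do
  let d ← read (.degree x)
  let o ← read (.slot d)
  match o with
  | none =>
    write (.slot d) (some x)
    pure d
  | some y =>
    write (.slot d) none
    let kx ← read (.dist x)
    let ky ← read (.dist y)
    let b ← compute (decide (ky < kx))
    if b then
      link x y
      place y
    else
      link y x
      place x
  partial_fixpoint

/-- Empty the root list into the slots. Returns the largest index of a slot used. -/
def gather (top : ℕ) : Prog (Region Q A) ℕ := do
  let o ← read (.first none)
  match o with
  | none => pure top
  | some w =>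
    unlink w
    let d ← place w
    let top' ← compute (max top d)
    gather top'
  partial_fixpoint

/-- Consolidate the root list, so that the degrees of the roots are distinct, and find the root
with the least key. -/
def consolidate : Prog (Region Q A) Unit := do
  write .minRoot none
  let top ← gather 0
  (List.range (top + 1)).forM fun d => do
    let o ← read (.slot d)
    match o with
    | none => pure ()
    | some x =>
      write (.slot d) none
      push none x
      updateMin x

/-- Move the children of `z` to the root list. -/
def releaseChildren (z : Node Q A) : Prog (Region Q A) Unit := do
  let o ← read (.first (some z))
  match o with
  | none => pure ()
  | some w =>
    unlink w
    push none w
    releaseChildren z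
  partial_fixpoint

/-- Delete `z`, the root with the least key. -/
def deleteMin (z : Node Q A) : Prog (Region Q A) Unit := do
  unlink z
  releaseChildren z
  consolidate

/-- Cut `x` off its parent `y`, and make it a root. -/
def cut (x y : Node Q A) : Prog (Region Q A) Unit := do
  unlink x
  let d ← read (.degree y)
  let d' ← compute ((d - 1 : ℕ))
  write (.degree y) d'
  push none x
  write (.mark x) false

/-- The node `y` has lost a child: mark it, or cut it if it is already marked. -/
def cascadingCut (y : Node Q A) : Prog (Region Q A) Unit := do
  let p ← read (.parent y)
  match p with
  | none => pure ()
  | some z =>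
    let b ← read (.mark y)
    match b with
    | false => write (.mark y) true
    | true =>
      cut y z
      cascadingCut z
  partial_fixpoint

/-- Decrease the key of `v` to `k`. -/
def decreaseKey (v : Node Q A) (k : ℝ≥0∞) : Prog (Region Q A) Unit := do
  write (.dist v) k
  let p ← read (.parent v)
  match p with
  | none => pure ()
  | some y =>
    let ky ← read (.dist y)
    let b ← compute (decide (k < ky))
    if b then
      cut v y
      cascadingCut y
    else pure ()
  updateMin v

/-! ### Dijkstra's algorithm on the augmented machine -/

/-- Initialise the search: no node is reached, the heap is empty. -/
def initSearch : Prog (Region Q A) Unit := do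
  (FinEnum.toList (Node Q A)).forM fun v => do
    write (.dist v) (⊤ : ℝ≥0∞)
    write (.pred v) none
    write (.status v) Status.fresh
  (List.range (FinEnum.card (Node Q A) + 1)).forM fun d => write (.slot d) none
  write (.first none) none
  write .minRoot none
  write .exitsLeft (FinEnum.card A)

/-- Use the arc of the augmented machine that leaves the settled state `q` with the input `x`. -/
def relax (q : Q) (x : A) : Prog (Region Q A) Unit := do
  let v ← read (.deltaHat q x)
  let st ← read (.status v)
  match st with
  | .settled => pure ()
  | .fresh =>
    let k ← read (.dist (Sum.inl q))
    let w ← read (.gammaHat q x)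
    let k' ← compute (k + w : ℝ≥0∞)
    let b ← compute (decide (k' < ⊤))
    if b then
      write (.dist v) k'
      write (.pred v) (some (q, x))
      write (.status v) Status.queued
      insert v
    else pure ()
  | .queued =>
    let k ← read (.dist (Sum.inl q))
    let w ← read (.gammaHat q x)
    let k' ← compute (k + w : ℝ≥0∞)
    let kv ← read (.dist v)
    let b ← compute (decide (k' < kv))
    if b then
      write (.pred v) (some (q, x))
      decreaseKey v k'
    else pure ()

/-- The main loop: settle nodes in the order of their distances, until all exit states are
settled or no reached node is left. -/
def search : Prog (Region Q A) Unit := do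
  let m ← read .minRoot
  match m with
  | none => pure ()
  | some u =>
    let r ← read .exitsLeft
    let b ← compute (decide (r = (0 : ℕ)))
    if b then pure ()
    else
      deleteMin u
      write (.status u) Status.settled
      match u with
      | Sum.inr _ =>
        let r' ← compute ((r - 1 : ℕ))
        write .exitsLeft r'
      | Sum.inl q => (FinEnum.toList A).forM fun x => relax q x
      search
  partial_fixpoint

/-- Follow the arcs `pred` back from `v`, and collect them in front of `z`. -/
def traceBack (v : Node Q A) (z : List (Q × A)) : Prog (Region Q A) (List (Q × A)) := do
  let p ← read (.pred v)
  match p with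
  | none => pure z
  | some (q, x) =>
    let z' ← compute ((q, x) :: z)
    traceBack (Sum.inl q) z'
  partial_fixpoint

/-- Dijkstra's algorithm on the augmented machine, from `s` to all exit states. It writes down
the distances of the exit states (`⊤` for those that are not reached) and corresponding trajectories
of the augmented machine (the empty list for those that are not reached). -/
def dijkstra (s : Q) : Prog (Region Q A) Unit := do
  initSearch
  write (.dist (Sum.inl s)) (0 : ℝ≥0∞)
  write (.status (Sum.inl s)) Status.queued
  insert (Sum.inl s)
  search
  (FinEnum.toList A).forM fun x => do
    let c ← read (.dist (E x))
    write (.exitCost x) c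
    let z ← traceBack (E x) []
    write (.exitTraj x) z

end Local

/-! ### The offline step -/

/-- Construct the augmented machine: a transition of the machine is kept, and costs in addition
the exit cost of its source; where the input `x` has no transition, there is one to the exit state
`E x`, at the exit cost of its source. The functions of the machine are stored as tables, and a
look-up in one is one step. -/
def constructAugmented {A : Type} [FinEnum A] (M : MealyMachine A) :
    Prog (Region M.Q A) Unit :=
  (FinEnum.toList M.Q).forM fun q => (FinEnum.toList A).forM fun x => do
    let c ← read (.childCost q x)
    let v ← compute (M.δ q x)
    match v with
    | some q' =>
      let g ← compute (M.γ q x)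
      let w ← compute (c + (g : ℝ≥0∞))
      write (.deltaHat q x) (Sum.inl q')
      write (.gammaHat q x) w
    | none =>
      write (.deltaHat q x) (E x)
      write (.gammaHat q x) c

/-- The memory of the offline step: one region for each machine. -/
abbrev Store {A : Type} (Z : Hierarchy A) := (M : Z.X) → Region (Z.machine M).Q A

/-- The recursive procedure. It first computes, for all states of the machine `M`, their exit costs:
zero for a state that is not refined, and by a recursive call otherwise. -/
def optimalExit {A : Type} [FinEnum A] (Z : Hierarchy A) (M : Z.X) : Prog (Store Z) Unit := do
  (FinEnum.toList (Z.machine M).Q).forM fun q => do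
    let o ← compute (Z.child M q)
    match o with
    | none =>
      (FinEnum.toList A).forM fun x => inRegion M (write (.childCost q x) (0 : ℝ≥0∞))
    | some M' =>
      optimalExit Z M'
      (FinEnum.toList A).forM fun x => do
        let c ← inRegion M' (read (.exitCost x))
        inRegion M (write (.childCost q x) c)
  inRegion M (constructAugmented (Z.machine M))
  inRegion M (dijkstra (Z.machine M).start)
  partial_fixpoint

/-- The offline step: after it, the cells `exitCost` and `exitTraj` in the region of every machine
hold its optimal exit costs and trajectories. -/
def offlineStep {A : Type} [FinEnum A] (Z : Hierarchy A) : Prog (Store Z) Unit :=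
  optimalExit Z Z.root

end HiMM

end

/-! Let a machine have q states and let s be the number of inputs. Copying exit costs and filling
the tables of the augmented machine takes O(qs) steps. The rest is one run of Dijkstra's algorithm
on a graph with n = q + s nodes and qs arcs, since exit states have no outgoing arcs. Each node is
settled at most once and each arc is used at most once. With a Fibonacci heap, a deletion of the
minimum takes O(log n) amortised steps, and an insertion or a decrease of a key O(1). Reading off s
trajectories with at most q arcs of the machine each adds O(qs), so the run takes O(qs + n log n)
steps (`wp_dijkstra`). The machines form a tree, so the recursion treats each of them at most once,
and the bounds add up over the descendants (`sum_descendants_le`, `wp_optimalExit`). Finally, the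
bound for one machine is monotone in q.

The heap analysis rests on two facts. First, degrees are logarithmic. A node becomes a child only of
a node of the same degree and may lose just one child before it is cut off. Hence a child with i
older siblings has degree at least i - 1, and a node of degree d has at least fib (d + 2)
descendants (`Forest.fib_degree_le`). Second, 26 times (number of roots + 2 · number of marked
nodes) is a potential. It pays for consolidating long root lists (`wp_consolidate`, `wp_deleteMin`)
and for cascades of cuts (`wp_cascadingCut`).

The programs are partial, so termination has to be proved with the bounds; `wp` expresses both. The
computed distances need not be correct for this. What is needed is that the pointers represent a
forest, that `minRoot` points to a root, and that the arcs `pred` contain no cycle among settled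
states. The order of the keys is still part of the invariant, because it keeps `minRoot` on a root
when the key of an inner node decreases. -/

noncomputable section

namespace HiMM

/-! ### Total correctness with step counting -/

/-- Started in the memory `m` after `k` steps, `p` terminates, and its result, the final memory and
the final number of steps satisfy `R`. -/
def wp {S α : Type} (p : Prog S α) (m : S) (k : ℕ) (R : α → S → ℕ → Prop) : Prop :=
  ∃ a m' k', p ⟨m, k⟩ = some (a, ⟨m', k'⟩) ∧ R a m' k'

section WP

variable {S α β : Type} {m : S} {k : ℕ}

theorem wp.mono {p : Prog S α} {R R' : α → S → ℕ → Prop} (h : wp p m k R)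
    (hR : ∀ a m' k', R a m' k' → R' a m' k') : wp p m k R' := by
  obtain ⟨a, m', k', h1, h2⟩ := h
  exact ⟨a, m', k', h1, hR _ _ _ h2⟩

theorem wp_pure {a : α} {R : α → S → ℕ → Prop} :
    wp (pure a : Prog S α) m k R ↔ R a m k := by
  constructor
  · rintro ⟨a', m', k', h, h2⟩
    cases h
    exact h2
  · intro h
    exact ⟨a, m, k, rfl, h⟩

theorem wp_bind {p : Prog S α} {f : α → Prog S β} {R : β → S → ℕ → Prop} :
    wp (p >>= f) m k R ↔ wp p m k fun a m' k' => wp (f a) m' k' R := by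
  have key : (p >>= f) ⟨m, k⟩ = (p ⟨m, k⟩).bind fun r => f r.1 r.2 := rfl
  constructor
  · rintro ⟨b, m', k', h, h2⟩
    rw [key, Option.bind_eq_some_iff] at h
    obtain ⟨⟨a, m1⟩, h3, h4⟩ := h
    exact ⟨a, m1.mem, m1.steps, h3, b, m', k', h4, h2⟩
  · rintro ⟨a, m1, k1, h1, b, m', k', h2, h3⟩
    refine ⟨b, m', k', ?_, h3⟩
    rw [key, h1]
    exact h2

theorem wp_compute {a : α} {R : α → S → ℕ → Prop} :
    wp (compute a : Prog S α) m k R ↔ R a m (k + 1) := by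
  constructor
  · rintro ⟨a', m', k', h, h2⟩
    cases h
    exact h2
  · intro h
    exact ⟨a, m, k + 1, rfl, h⟩

theorem wp_inRegion {X : Type} [DecidableEq X] {S : X → Type} {α : Type} {i : X}
    {p : Prog (S i) α} {m : (j : X) → S j} {k : ℕ} {R : α → ((j : X) → S j) → ℕ → Prop}
    (h : wp p (m i) k fun a s k' => R a (Function.update m i s) k') :
    wp (inRegion i p) m k R := by
  obtain ⟨a, m', k', h1, h2⟩ := h
  refine ⟨a, _, k', ?_, h2⟩
  simp [inRegion, h1]

/-- A loop over a list, with an invariant that refers to the elements still to be treated. -/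
theorem wp_forM {f : α → Prog S PUnit} (I : List α → S → ℕ → Prop) {l : List α}
    (h0 : I l m k)
    (hstep : ∀ a l' m k, I (a :: l') m k → wp (f a) m k fun _ m' k' => I l' m' k') :
    wp (l.forM f) m k fun _ m' k' => I [] m' k' := by
  induction l generalizing m k with
  | nil => exact wp_pure.2 h0
  | cons a l ih =>
    refine wp_bind.2 ?_
    exact (hstep a l m k h0).mono fun _ m' k' h => ih h

/-- A loop over `0, …, n - 1`, with an invariant that refers to the index. -/
theorem wp_forM_range {f : ℕ → Prog S PUnit} (I : ℕ → S → ℕ → Prop) {n : ℕ}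
    (h0 : I 0 m k)
    (hstep : ∀ i m k, i < n → I i m k → wp (f i) m k fun _ m' k' => I (i + 1) m' k') :
    wp ((List.range n).forM f) m k fun _ m' k' => I n m' k' := by
  have key : ∀ j i m k, i + j = n → I i m k →
      wp ((List.range' i j).forM f) m k fun _ m' k' => I n m' k' := by
    intro j
    induction j with
    | zero => intro i m k hi h; simp at hi; subst hi; exact wp_pure.2 h
    | succ j ih =>
      intro i m k hi h
      rw [List.range'_succ]
      refine wp_bind.2 ?_
      exact (hstep i m k (by omega) h).mono fun _ m' k' h' => ih (i + 1) m' k' (by omega) h'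
  rw [List.range_eq_range']
  exact key n 0 m k (by simp) h0

end WP

section Region

variable {Q A : Type} {m : Region Q A} {k : ℕ}

theorem wp_read {c : Cell Q A} {R : c.Val → Region Q A → ℕ → Prop} :
    wp (α := no_index c.Val) (read c) m k R ↔ R (m c) m (k + 1) := by
  constructor
  · rintro ⟨a', m', k', h, h2⟩
    cases h
    exact h2
  · intro h
    exact ⟨_, m, k + 1, rfl, h⟩

theorem wp_write [DecidableEq Q] [DecidableEq A] {c : Cell Q A} {a : c.Val}
    {R : Unit → Region Q A → ℕ → Prop} :
    wp (write c a) m k R ↔ R () (Function.update m c a) (k + 1) := by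
  constructor
  · rintro ⟨a', m', k', h, h2⟩
    cases h
    exact h2
  · intro h
    exact ⟨_, _, k + 1, rfl, h⟩

end Region

theorem length_toList {α : Type} [FinEnum α] : (FinEnum.toList α).length = FinEnum.card α := by
  simp [FinEnum.toList]

/-! ### The two halves of a memory region -/

/-- The pointers of the heap. -/
@[ext]
structure Ptr (Q A : Type) where
  parent : Node Q A → Option (Node Q A)
  first : Option (Node Q A) → Option (Node Q A)
  next : Node Q A → Option (Node Q A)
  prev : Node Q A → Option (Node Q A)

/-- The other relevant data of the heap and of the search. -/
@[ext]
structure Aux (Q A : Type) where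
  degree : Node Q A → ℕ
  mark : Node Q A → Bool
  minRoot : Option (Node Q A)
  slot : ℕ → Option (Node Q A)
  dist : Node Q A → ℝ≥0∞
  status : Node Q A → Status
  pred : Node Q A → Option (Q × A)

section Halves

variable {Q A : Type}

/-- The pointers stored in a memory region. -/
def ptr (m : Region Q A) : Ptr Q A where
  parent v := m (.parent v)
  first p := m (.first p)
  next v := m (.next v)
  prev v := m (.prev v)

/-- The other data stored in a memory region. -/
def aux (m : Region Q A) : Aux Q A where
  degree v := m (.degree v)
  mark v := m (.mark v)
  minRoot := m .minRoot
  slot d := m (.slot d)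
  dist v := m (.dist v)
  status v := m (.status v)
  pred v := m (.pred v)

variable [FinEnum Q] [FinEnum A] (m : Region Q A)

-- A write affects at most one field of one half, so these rules evaluate both halves after any
-- sequence of writes. List operations change only pointers, and everything else leaves the pointers
-- alone.
@[simp] theorem ptr_update_parent (v : Node Q A) (x) : ptr (Function.update m (.parent v) x) =
    { ptr m with parent := Function.update (ptr m).parent v x } := by
  ext <;> simp [ptr, Function.update_apply]
  grind

@[simp] theorem ptr_update_first (p : Option (Node Q A)) (x) :
    ptr (Function.update m (.first p) x) =
    { ptr m with first := Function.update (ptr m).first p x } := by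
  ext <;> simp [ptr, Function.update_apply]
  grind

@[simp] theorem ptr_update_next (v : Node Q A) (x) : ptr (Function.update m (.next v) x) =
    { ptr m with next := Function.update (ptr m).next v x } := by
  ext <;> simp [ptr, Function.update_apply]
  grind

@[simp] theorem ptr_update_prev (v : Node Q A) (x) : ptr (Function.update m (.prev v) x) =
    { ptr m with prev := Function.update (ptr m).prev v x } := by
  ext <;> simp [ptr, Function.update_apply]
  grind

@[simp] theorem ptr_update_degree (v : Node Q A) (y) :
    ptr (Function.update m (.degree v) y) = ptr m := by
  simp [ptr]

@[simp] theorem ptr_update_mark (v : Node Q A) (y) :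
    ptr (Function.update m (.mark v) y) = ptr m := by
  simp [ptr]

@[simp] theorem ptr_update_minRoot (y) :
    ptr (Function.update m .minRoot y) = ptr m := by
  simp [ptr]

@[simp] theorem ptr_update_slot (d : ℕ) (y) :
    ptr (Function.update m (.slot d) y) = ptr m := by
  simp [ptr]

@[simp] theorem ptr_update_dist (v : Node Q A) (y) :
    ptr (Function.update m (.dist v) y) = ptr m := by
  simp [ptr]

@[simp] theorem ptr_update_status (v : Node Q A) (y) :
    ptr (Function.update m (.status v) y) = ptr m := by
  simp [ptr]

@[simp] theorem ptr_update_pred (v : Node Q A) (y) :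
    ptr (Function.update m (.pred v) y) = ptr m := by
  simp [ptr]

@[simp] theorem ptr_update_exitsLeft (y) :
    ptr (Function.update m .exitsLeft y) = ptr m := by
  simp [ptr]

@[simp] theorem aux_update_parent (v : Node Q A) (y) :
    aux (Function.update m (.parent v) y) = aux m := by
  simp [aux]

@[simp] theorem aux_update_first (p : Option (Node Q A)) (y) :
    aux (Function.update m (.first p) y) = aux m := by
  simp [aux]

@[simp] theorem aux_update_next (v : Node Q A) (y) :
    aux (Function.update m (.next v) y) = aux m := by
  simp [aux]

@[simp] theorem aux_update_prev (v : Node Q A) (y) :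
    aux (Function.update m (.prev v) y) = aux m := by
  simp [aux]

@[simp] theorem aux_update_exitsLeft (y) :
    aux (Function.update m .exitsLeft y) = aux m := by
  simp [aux]

@[simp] theorem aux_update_exitCost (x : A) (y) :
    aux (Function.update m (.exitCost x) y) = aux m := by
  simp [aux]

@[simp] theorem aux_update_exitTraj (x : A) (y) :
    aux (Function.update m (.exitTraj x) y) = aux m := by
  simp [aux]

@[simp] theorem aux_update_degree (v : Node Q A) (y) : aux (Function.update m (.degree v) y) =
    { aux m with degree := Function.update (aux m).degree v y } := by
  ext <;> simp [aux, Function.update_apply]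
  grind

@[simp] theorem aux_update_mark (v : Node Q A) (y) : aux (Function.update m (.mark v) y) =
    { aux m with mark := Function.update (aux m).mark v y } := by
  ext <;> simp [aux, Function.update_apply]
  grind

@[simp] theorem aux_update_minRoot (y) :
    aux (Function.update m .minRoot y) = { aux m with minRoot := y } := by
  simp [aux]

@[simp] theorem aux_update_slot (d : ℕ) (y) : aux (Function.update m (.slot d) y) =
    { aux m with slot := Function.update (aux m).slot d y } := by
  ext <;> simp [aux, Function.update_apply]
  grind

@[simp] theorem aux_update_dist (v : Node Q A) (y) : aux (Function.update m (.dist v) y) =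
    { aux m with dist := Function.update (aux m).dist v y } := by
  ext <;> simp [aux, Function.update_apply]
  grind

@[simp] theorem aux_update_status (v : Node Q A) (y) : aux (Function.update m (.status v) y) =
    { aux m with status := Function.update (aux m).status v y } := by
  ext <;> simp [aux, Function.update_apply]
  grind

@[simp] theorem aux_update_pred (v : Node Q A) (y) : aux (Function.update m (.pred v) y) =
    { aux m with pred := Function.update (aux m).pred v y } := by
  ext <;> simp [aux, Function.update_apply]
  grind

end Halves

/-! ### Doubly linked lists -/

section Links

set_option linter.unusedSectionVars false

variable {Q A : Type} [FinEnum Q] [FinEnum A]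

/-- The pointers `r` represent the doubly linked lists `K p`, where `K none` is the root list, and
`K (some v)` is the list of children of the node `v`. The lists of the nodes outside `H` need not
have a pointer to their beginning. -/
structure Links (r : Ptr Q A) (H : Finset (Node Q A)) (K : Option (Node Q A) → List (Node Q A)) :
    Prop where
  first_none : r.first none = (K none).head?
  first_some : ∀ u ∈ H, r.first (some u) = (K (some u)).head?
  links : ∀ p l₁ v l₂, K p = l₁ ++ v :: l₂ → r.prev v = l₁.getLast? ∧ r.next v = l₂.head?
  nodup : ∀ p, (K p).Nodup
  parent : ∀ p, ∀ v ∈ K p, r.parent v = p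

variable {r : Ptr Q A} {H : Finset (Node Q A)} {K : Option (Node Q A) → List (Node Q A)}

theorem Links.unique (h : Links r H K) {p q : Option (Node Q A)} {v : Node Q A} (hp : v ∈ K p)
    (hq : v ∈ K q) : p = q :=
  (h.parent p v hp).symm.trans (h.parent q v hq)

/-- The effect of `unlink v` on the pointers. -/
def Ptr.unlink (r : Ptr Q A) (p : Option (Node Q A)) (a b : Option (Node Q A)) : Ptr Q A where
  parent := r.parent
  first := fun q => if q = p ∧ a = none then b else r.first q
  next := fun w => if some w = a then b else r.next w
  prev := fun w => if some w = b then a else r.prev w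

/-- The cells of `v` itself keep stale values. This is harmless, because `Links` constrains only the
elements of lists. -/
theorem Links.erase (h : Links r H K) {p : Option (Node Q A)} {l₁ l₂ : List (Node Q A)}
    {v : Node Q A} (hK : K p = l₁ ++ v :: l₂) :
    Links (r.unlink p l₁.getLast? l₂.head?) H (Function.update K p (l₁ ++ l₂)) := by
  have hnd := h.nodup p
  rw [hK] at hnd
  have hnone : l₁.getLast? = none ↔ l₁ = [] := by simp
  have hfirst : ∀ q, r.first q = (K q).head? →
      (if q = p ∧ l₁.getLast? = none then l₂.head? else r.first q) =
        (Function.update K p (l₁ ++ l₂) q).head? := by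
    intro q hq
    by_cases hqp : q = p
    · subst hqp
      rcases l₁.eq_nil_or_concat with rfl | ⟨l, w, rfl⟩
      · simp
      · simp [hq, hK]
    · simp [hqp, hq]
  refine ⟨hfirst none h.first_none, fun u hu => hfirst _ (h.first_some u hu), ?_, ?_, ?_⟩
  · intro q x w y hq
    by_cases hqp : q = p
    · subst hqp
      rw [Function.update_self] at hq
      simp only [Ptr.unlink]
      have hhead : ∀ {l : List (Node Q A)}, w ∉ l → ¬ some w = l.head? :=
        fun hl hh => hl (List.mem_of_head? hh.symm)
      have hlast : ∀ {l : List (Node Q A)}, w ∉ l → ¬ some w = l.getLast? :=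
        fun hl hh => hl (List.mem_of_getLast? hh.symm)
      -- The case that `w` comes after `v`: only its backward pointer can change, namely if `w` is
      -- the direct successor of `v`.
      have hright : ∀ z, l₂ = z ++ w :: y → x = l₁ ++ z →
          (if some w = l₂.head? then l₁.getLast? else r.prev w) = x.getLast? ∧
            (if some w = l₁.getLast? then l₂.head? else r.next w) = y.head? := by
        rintro z rfl rfl
        have hlk := h.links q (l₁ ++ v :: z) w y (by simp [hK])
        have hw : w ∉ l₁ := fun hw => by
          have := List.disjoint_of_nodup_append hnd hw
          simp at this
        rw [if_neg (hlast hw), hlk.1, hlk.2]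
        cases z with
        | nil => simp
        | cons b z =>
          have : w ≠ b := by rintro rfl; simp [List.nodup_append] at hnd
          simp [this]
      rcases List.append_eq_append_iff.1 hq with ⟨z, hx, hz⟩ | ⟨z, hx, hz⟩
      · exact hright z hz hx
      · cases z with
        | nil => exact hright [] (by simpa using hz.symm) (by simpa using hx.symm)
        | cons c z =>
          -- Now `w` comes before `v`, and only its forward pointer can change.
          simp only [List.cons_append, List.cons.injEq] at hz
          obtain ⟨rfl, rfl⟩ := hz
          subst hx
          have hlk := h.links q x w (z ++ v :: l₂) (by simp [hK])
          have hw : w ∉ l₂ := fun hw => by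
            have := List.disjoint_of_nodup_append hnd (a := w) (by simp)
            simp [hw] at this
          rw [if_neg (hhead hw), hlk.1, hlk.2]
          refine ⟨rfl, ?_⟩
          rcases z.eq_nil_or_concat with rfl | ⟨z, b, rfl⟩
          · simp
          · have : w ≠ b := by rintro rfl; simp [List.nodup_append] at hnd
            rw [show x ++ w :: z.concat b = (x ++ w :: z) ++ [b] by simp, List.getLast?_concat,
              if_neg (by simpa using this)]
            cases z <;> simp
    · rw [Function.update_of_ne hqp] at hq
      have hw : w ∈ K q := by simp [hq]
      have h1 : ∀ w', w' ∈ K p → w ≠ w' := by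
        rintro w' hw' rfl
        exact hqp (h.unique hw hw')
      have := h.links q x w y hq
      simp only [Ptr.unlink]
      rw [if_neg, if_neg]
      · exact this
      · intro hw'
        exact h1 w (by rw [hK]; simp [List.mem_of_getLast? hw'.symm]) rfl
      · intro hw'
        exact h1 w (by rw [hK]; simp [List.mem_of_head? hw'.symm]) rfl
  · intro q
    by_cases hqp : q = p
    · subst hqp
      rw [Function.update_self]
      exact hnd.sublist (by simp)
    · rw [Function.update_of_ne hqp]
      exact h.nodup q
  · intro q w hw
    refine h.parent q w ?_
    by_cases hqp : q = p
    · subst hqp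
      rw [Function.update_self] at hw
      rw [hK]
      simp at hw ⊢
      tauto
    · rwa [Function.update_of_ne hqp] at hw

/-- The effect of `push p v` on the pointers. -/
def Ptr.push (r : Ptr Q A) (p : Option (Node Q A)) (v : Node Q A) : Ptr Q A where
  parent := Function.update r.parent v p
  first := Function.update r.first p (some v)
  next := Function.update r.next v (r.first p)
  prev := fun w => if some w = r.first p then some v else if w = v then none else r.prev w

theorem Links.cons (h : Links r H K) {p : Option (Node Q A)} {v : Node Q A}
    (hp : ∀ u, p = some u → u ∈ H) (hv : ∀ q, v ∉ K q) :
    Links (r.push p v) H (Function.update K p (v :: K p)) := by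
  have hf : r.first p = (K p).head? := by
    cases p with
    | none => exact h.first_none
    | some u => exact h.first_some u (hp u rfl)
  have hfirst : ∀ q, r.first q = (K q).head? →
      Function.update r.first p (some v) q = (Function.update K p (v :: K p) q).head? := by
    intro q hq
    by_cases hqp : q = p
    · subst hqp; simp
    · simp [hqp, hq]
  refine ⟨hfirst none h.first_none, fun u hu => hfirst _ (h.first_some u hu), ?_, ?_, ?_⟩
  · intro q x w y hq
    simp only [Ptr.push, hf]
    have hne : ∀ q, w ∈ K q → w ≠ v := fun q hw => by rintro rfl; exact hv q hw
    by_cases hqp : q = p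
    · subst hqp
      rw [Function.update_self] at hq
      have hnd := h.nodup q
      cases x with
      | nil =>
        simp at hq
        obtain ⟨rfl, rfl⟩ := hq
        have : some v ≠ (K q).head? := fun hh => hv q (List.mem_of_head? hh.symm)
        simp [this]
      | cons a x =>
        simp at hq
        obtain ⟨rfl, hq⟩ := hq
        have hw := hne q (by simp [hq])
        have := h.links q x w y hq
        rw [hq] at hnd
        simp [hw, this, hq]
        cases x with
        | nil => simp
        | cons b x =>
          have : w ≠ b := by rintro rfl; simp at hnd
          simp [this]
    · rw [Function.update_of_ne hqp] at hq
      have hw : w ∈ K q := by simp [hq]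
      have h1 : some w ≠ (K p).head? := fun hh =>
        hqp (h.unique hw (List.mem_of_head? hh.symm))
      simp [hne q hw, h1, h.links q x w y hq]
  · intro q
    by_cases hqp : q = p
    · subst hqp
      rw [Function.update_self]
      exact (h.nodup q).cons (hv q)
    · rw [Function.update_of_ne hqp]
      exact h.nodup q
  · intro q w hw
    simp only [Ptr.push]
    by_cases hqp : q = p
    · subst hqp
      rw [Function.update_self] at hw
      rcases List.mem_cons.1 hw with hw' | hw'
      · simp [hw']
      · have : w ≠ v := by rintro rfl; exact hv q hw'
        simp [this, h.parent q w hw']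
    · rw [Function.update_of_ne hqp] at hw
      have : w ≠ v := by rintro rfl; exact hv q hw
      simp [this, h.parent q w hw]

/-- A memory region holds the lists `K` and the data `a`. -/
structure Holds (m : Region Q A) (H : Finset (Node Q A))
    (K : Option (Node Q A) → List (Node Q A)) (a : Aux Q A) : Prop where
  links : Links (ptr m) H K
  aux : aux m = a

variable {m : Region Q A} {k : ℕ} {a : Aux Q A}

theorem wp_unlink (h : Holds m H K a) {p : Option (Node Q A)} {l₁ l₂ : List (Node Q A)}
    {v : Node Q A} (hK : K p = l₁ ++ v :: l₂) :
    wp (unlink v) m k fun _ m' k' => k' ≤ k + 5 ∧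
      Holds m' H (Function.update K p (l₁ ++ l₂)) a := by
  obtain rfl : p = m (.parent v) := Eq.symm <| h.links.parent p v (by simp [hK])
  have hl := h.links.links _ l₁ v l₂ hK
  have hprev : m (.prev v) = l₁.getLast? := hl.1
  have hnext : m (.next v) = l₂.head? := hl.2
  have key : ∀ m' k', ptr m' = (ptr m).unlink (m (.parent v)) l₁.getLast? l₂.head? →
      HiMM.aux m' = HiMM.aux m → k' ≤ k + 5 → k' ≤ k + 5 ∧
        Holds m' H (Function.update K (m (.parent v)) (l₁ ++ l₂)) a :=
    fun m' k' h1 h2 h3 => ⟨h3, h1 ▸ h.links.erase hK, h2.trans h.aux⟩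
  simp only [unlink, wp_bind, wp_read, hprev, hnext]
  cases h1 : l₁.getLast? <;> cases h2 : l₂.head? <;>
    simp only [wp_bind, wp_write, wp_pure] <;> rw [h1, h2] at key <;> apply key
  all_goals first | omega | skip
  all_goals
    simp only [ptr_update_first, ptr_update_next, ptr_update_prev, aux_update_first,
      aux_update_next, aux_update_prev, Ptr.unlink, Ptr.mk.injEq, true_and, and_true]
  all_goals simp [funext_iff, Function.update_apply]

theorem wp_push (h : Holds m H K a) {p : Option (Node Q A)} {v : Node Q A}
    (hp : ∀ u, p = some u → u ∈ H) (hv : ∀ q, v ∉ K q) :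
    wp (push p v) m k fun _ m' k' => k' ≤ k + 6 ∧
      Holds m' H (Function.update K p (v :: K p)) a := by
  have key : ∀ m' k', ptr m' = (ptr m).push p v → HiMM.aux m' = HiMM.aux m →
      k' ≤ k + 6 → k' ≤ k + 6 ∧ Holds m' H (Function.update K p (v :: K p)) a :=
    fun m' k' h1 h2 h3 => ⟨h3, h1 ▸ h.links.cons hp hv, h2.trans h.aux⟩
  have hf : m (.first p) = (ptr m).first p := rfl
  simp only [push, wp_bind, wp_read, wp_write, hf]
  cases h1 : (ptr m).first p <;>
    simp only [wp_write, wp_pure] <;> apply key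
  all_goals first | omega | skip
  all_goals simp [Ptr.push, h1, funext_iff, Function.update_apply]

theorem Holds.of_eq {m' : Region Q A} {a' : Aux Q A} (h : Holds m H K a)
    (h1 : ptr m' = ptr m) (h2 : HiMM.aux m' = a') : Holds m' H K a' :=
  ⟨h1 ▸ h.links, h2⟩

theorem Holds.subset {H' : Finset (Node Q A)} (h : Holds m H K a) (hH : H' ⊆ H) :
    Holds m H' K a :=
  ⟨{ h.links with first_some := fun u hu => h.links.first_some u (hH hu) }, h.aux⟩

/-- The cell `first` of a node outside `H` may contain anything, as it is never initialised.
Clearing it makes it valid for a node without children. -/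
theorem Holds.insert (h : Holds m H K a) {v : Node Q A} (hv : K (some v) = []) :
    Holds (Function.update m (.first (some v)) none) (Insert.insert v H) K a := by
  refine ⟨?_, by simp [h.aux]⟩
  rw [ptr_update_first]
  refine ⟨by simpa using h.links.first_none, fun u hu => ?_, h.links.links, h.links.nodup,
    h.links.parent⟩
  by_cases huv : u = v
  · subst huv; simp [hv]
  · simpa [huv] using h.links.first_some u (Finset.mem_of_mem_insert_of_ne hu huv)

theorem Holds.degree (h : Holds m H K a) (v : Node Q A) : m (.degree v) = a.degree v := by
  rw [← h.aux]; rfl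

theorem Holds.mark (h : Holds m H K a) (v : Node Q A) : m (.mark v) = a.mark v := by
  rw [← h.aux]; rfl

theorem Holds.minRoot (h : Holds m H K a) : m .minRoot = a.minRoot := by
  rw [← h.aux]; rfl

theorem Holds.slot (h : Holds m H K a) (d : ℕ) : m (.slot d) = a.slot d := by
  rw [← h.aux]; rfl

theorem Holds.dist (h : Holds m H K a) (v : Node Q A) : m (.dist v) = a.dist v := by
  rw [← h.aux]; rfl

theorem Holds.status (h : Holds m H K a) (v : Node Q A) : m (.status v) = a.status v := by
  rw [← h.aux]; rfl

theorem Holds.pred (h : Holds m H K a) (v : Node Q A) : m (.pred v) = a.pred v := by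
  rw [← h.aux]; rfl

end Links

/-! ### Descendants -/

section Descendants

variable {α : Type} [Fintype α] {R : α → α → Prop}

open Classical in
/-- The nodes that can be reached from `u`. -/
def descendants (R : α → α → Prop) (u : α) : Finset α :=
  Finset.univ.filter (Relation.ReflTransGen R u)

theorem mem_descendants {u v : α} : v ∈ descendants R u ↔ Relation.ReflTransGen R u v := by
  simp [descendants]

/-- Parents are unique, so the ancestors of a common descendant form a chain, and one of `v`, `w`
lies below the other. Its parent `u` would then be its own ancestor. -/
theorem descendants_disjoint (huniq : ∀ u u' v, R u v → R u' v → u = u')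
    (hacyc : ∀ v, ¬ Relation.TransGen R v v) {u v w : α} (hv : R u v) (hw : R u w) (hvw : v ≠ w) :
    Disjoint (descendants R v) (descendants R w) := by
  have key : ∀ {v w : α}, R u v → R u w → v ≠ w → ¬ Relation.ReflTransGen R v w := by
    intro v w hv hw hvw h
    rcases Relation.ReflTransGen.cases_tail h with h | ⟨z, h1, h2⟩
    · exact hvw h.symm
    · obtain rfl := huniq _ _ _ h2 hw
      exact hacyc z (Relation.TransGen.head' hv h1)
  rw [Finset.disjoint_left]
  intro y h1 h2
  rw [mem_descendants] at h1 h2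
  rcases Relation.ReflTransGen.total_of_right_unique (r := Function.swap R)
    (fun a b c hab hac => huniq _ _ _ hab hac) (Relation.reflTransGen_swap.2 h1)
    (Relation.reflTransGen_swap.2 h2) with h | h
  · exact key hw hv hvw.symm (Relation.reflTransGen_swap.1 h)
  · exact key hv hw hvw (Relation.reflTransGen_swap.1 h)

/-- The sums over the descendants of the children of `u` add up. -/
theorem sum_descendants_le (huniq : ∀ u u' v, R u v → R u' v → u = u')
    (hacyc : ∀ v, ¬ Relation.TransGen R v v) (f : α → ℕ) {u : α} {s : Finset α}
    (hs : ∀ v ∈ s, R u v) :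
    f u + ∑ v ∈ s, ∑ y ∈ descendants R v, f y ≤ ∑ y ∈ descendants R u, f y := by
  classical
  have hdisj : (s : Set α).PairwiseDisjoint (descendants R) := fun v hv w hw hvw =>
    descendants_disjoint huniq hacyc (hs v hv) (hs w hw) hvw
  rw [← Finset.sum_biUnion hdisj]
  have hu : u ∉ s.biUnion (descendants R) := by
    simp only [Finset.mem_biUnion, not_exists, not_and, mem_descendants]
    exact fun v hv h => hacyc u (Relation.TransGen.head' (hs v hv) h)
  rw [← Finset.sum_insert hu]
  refine Finset.sum_le_sum_of_subset fun y hy => ?_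
  rw [mem_descendants]
  rcases Finset.mem_insert.1 hy with rfl | hy
  · exact .refl
  · obtain ⟨v, hv, hy⟩ := Finset.mem_biUnion.1 hy
    exact .head (hs v hv) (mem_descendants.1 hy)

end Descendants

/-! ### The shape of a Fibonacci heap -/

/-- In a list of children, the bound `f` for the degree of each child is at least the number of its
older siblings. -/
def Fit {α : Type} (f : α → ℕ) : List α → Prop
  | [] => True
  | c :: l => l.length ≤ f c ∧ Fit f l

theorem Fit.mono {α : Type} {f g : α → ℕ} {l : List α} (h : Fit f l) (hfg : ∀ c ∈ l, f c ≤ g c) :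
    Fit g l := by
  induction l with
  | nil => trivial
  | cons c l ih =>
    exact ⟨h.1.trans (hfg c (by simp)), ih h.2 fun c hc => hfg c (by simp [hc])⟩

/-- Removing an element never increases the number of older siblings of another. -/
theorem Fit.erase {α : Type} {f : α → ℕ} {l₁ l₂ : List α} {c : α} (h : Fit f (l₁ ++ c :: l₂)) :
    Fit f (l₁ ++ l₂) := by
  induction l₁ with
  | nil => exact h.2
  | cons b l ih =>
    refine ⟨le_trans ?_ h.1, ih h.2⟩
    simp

/-- A list of children that fits has at least Fibonacci many descendants. -/
theorem Fit.fib_le {α : Type} {d s : α → ℕ} {l : List α} (h : Fit (fun c => d c + 1) l)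
    (hs : ∀ c ∈ l, Nat.fib (d c + 2) ≤ s c) : Nat.fib (l.length + 2) ≤ 1 + (l.map s).sum := by
  induction l with
  | nil => simp
  | cons c l ih =>
    have h1 := ih h.2 fun c hc => hs c (by simp [hc])
    have h2 := hs c (by simp)
    -- The youngest child contributes this summand, and its older siblings contribute the other
    -- summand of the Fibonacci recursion by induction.
    have h3 : Nat.fib (l.length + 1) ≤ Nat.fib (d c + 2) := Nat.fib_mono (by
      have : l.length ≤ d c + 1 := h.1
      omega)
    have h4 : Nat.fib (l.length + 1 + 2) = Nat.fib (l.length + 1) + Nat.fib (l.length + 2) :=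
      Nat.fib_add_two
    simp only [List.length_cons, List.map_cons, List.sum_cons]
    omega

section Forest

set_option linter.unusedSectionVars false

variable {Q A : Type} [FinEnum Q] [FinEnum A]

/-- A bound for the degree that the node `c` had when it became a child. The node `w` may have lost
one child more. -/
def Aux.bound (a : Aux Q A) (w : Option (Node Q A)) (c : Node Q A) : ℕ :=
  a.degree c + (a.mark c).toNat + if w = some c then 1 else 0

/-- The lists `K` form a forest on nodes of `H` that satisfies the conditions of a Fibonacci heap,
with an exception for the node `w`. Nodes of `H` that occur in no list are roots, too. -/
structure Forest (H : Finset (Node Q A)) (K : Option (Node Q A) → List (Node Q A))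
    (a : Aux Q A) (w : Option (Node Q A)) : Prop where
  rank : ∃ ht : Node Q A → ℕ, ∀ u, ∀ v ∈ K (some u), ht v < ht u
  mem : ∀ p, ∀ v ∈ K p, v ∈ H
  mem_parent : ∀ u, ∀ v ∈ K (some u), u ∈ H
  degree : ∀ v ∈ H, a.degree v = (K (some v)).length
  fit : ∀ u, Fit (a.bound w) (K (some u))

variable {r : Ptr Q A} {H : Finset (Node Q A)} {K : Option (Node Q A) → List (Node Q A)}
  {a : Aux Q A}

/-- By induction on the rank, the children of `v` have at least Fibonacci many descendants, and
these sets are disjoint. A mark costs at most one in the degree, which gives the bound `a.degree c +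
1` required by `Fit.fib_le`. -/
theorem Forest.fib_degree_le (h : Forest H K a none) (hl : Links r H K) {v : Node Q A}
    (hv : v ∈ H) : Nat.fib (a.degree v + 2) ≤ FinEnum.card (Node Q A) := by
  obtain ⟨ht, hht⟩ := h.rank
  let R : Node Q A → Node Q A → Prop := fun u v => v ∈ K (some u)
  have huniq : ∀ u u' v, R u v → R u' v → u = u' := fun u u' v h1 h2 =>
    Option.some.inj (hl.unique h1 h2)
  have hacyc : ∀ v, ¬ Relation.TransGen R v v := by
    have : ∀ u v, Relation.TransGen R u v → ht v < ht u := by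
      intro u v h
      induction h with
      | single h => exact hht _ _ h
      | tail _ h ih => exact (hht _ _ h).trans ih
    exact fun v h => lt_irrefl _ (this v v h)
  have key : ∀ n v, ht v < n → v ∈ H →
      Nat.fib (a.degree v + 2) ≤ (descendants R v).card := by
    intro n
    induction n with
    | zero => intro v hv; omega
    | succ n ih =>
      intro v hn hv
      have h1 := sum_descendants_le huniq hacyc (fun _ => 1) (u := v)
        (s := (K (some v)).toFinset) (fun c hc => by simpa using hc)
      simp only [Finset.sum_const, smul_eq_mul, mul_one] at h1
      rw [List.sum_toFinset _ (hl.nodup _)] at h1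
      rw [h.degree v hv]
      refine le_trans (Fit.fib_le (d := a.degree) ((h.fit v).mono fun c _ => ?_)
        fun c hc => ?_) h1
      · simp only [Aux.bound, reduceCtorEq, if_false]
        have := (a.mark c).toNat_le
        omega
      · exact ih c (by have := hht v c hc; omega) (h.mem _ c hc)
  rw [FinEnum.card_eq_fintypeCard]
  exact (key _ v (Nat.lt_succ_self _) hv).trans (Finset.card_le_univ _)

/-- A bound for the degrees in a Fibonacci heap with at most `n` nodes. -/
def degBound (n : ℕ) : ℕ := 2 * Nat.log 2 n + 1

/-- A Fibonacci number at least doubles when its index grows by two, as long as the index starts at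
2 or more. -/
theorem le_degBound {d n : ℕ} (h : Nat.fib (d + 2) ≤ n) : d ≤ degBound n := by
  have key : ∀ d, 2 ^ (d / 2) ≤ Nat.fib (d + 2) := by
    intro d
    induction d using Nat.strong_induction_on with
    | _ d ih =>
      match d with
      | 0 => simp
      | 1 => decide
      | d + 2 =>
        have h1 := ih d (by omega)
        have h2 : Nat.fib (d + 2 + 2) = Nat.fib (d + 2) + Nat.fib (d + 2 + 1) := Nat.fib_add_two
        have h3 : Nat.fib (d + 2) ≤ Nat.fib (d + 2 + 1) := Nat.fib_mono (by omega)
        rw [show (d + 2) / 2 = d / 2 + 1 by omega, pow_succ]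
        omega
  have h1 : 2 ^ (d / 2) ≤ n := (key d).trans h
  have h2 : d / 2 ≤ Nat.log 2 n := Nat.le_log_of_pow_le (by norm_num) h1
  unfold degBound
  omega

/-- A crude bound that keeps degrees within the range of slots that have been initialised. -/
theorem lt_of_fib_le {d n : ℕ} (h : Nat.fib (d + 2) ≤ n) : d < n := by
  have : ∀ d, d < Nat.fib (d + 2) := by
    intro d
    induction d with
    | zero => simp
    | succ d ih =>
      have h2 : Nat.fib (d + 1 + 2) = Nat.fib (d + 1) + Nat.fib (d + 1 + 1) := Nat.fib_add_two
      have h3 : 0 < Nat.fib (d + 1) := Nat.fib_pos.2 (by omega)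
      show d + 1 < Nat.fib (d + 1 + 2)
      have : d < Nat.fib (d + 1 + 1) := ih
      omega
  exact (this d).trans_le h

end Forest

/-! ### Consolidation -/

section Consolidate

set_option linter.unusedSectionVars false

variable {Q A : Type} [FinEnum Q] [FinEnum A] {m : Region Q A} {k : ℕ} {H : Finset (Node Q A)}
  {K : Option (Node Q A) → List (Node Q A)} {a : Aux Q A} {w : Option (Node Q A)}

/-- The lists agree with the order of the keys. -/
def Ordered (K : Option (Node Q A) → List (Node Q A)) (a : Aux Q A) : Prop :=
  ∀ u, ∀ v ∈ K (some u), a.dist u ≤ a.dist v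

/-- The forest does not depend on which of the roots are listed. -/
theorem Forest.of_roots {K' : Option (Node Q A) → List (Node Q A)} (h : Forest H K a w)
    (hK : ∀ u, K' (some u) = K (some u)) (hr : ∀ v ∈ K' none, v ∈ H) : Forest H K' a w where
  rank := by simpa only [hK] using h.rank
  mem := by
    rintro (_ | u) v hv
    · exact hr v hv
    · exact h.mem _ v (hK u ▸ hv)
  mem_parent := by simpa only [hK] using h.mem_parent
  degree := by simpa only [hK] using h.degree
  fit := by simpa only [hK] using h.fit

theorem Forest.link (h : Forest H K a none) {x y : Node Q A} (hx : x ∈ H) (hy : y ∈ H)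
    (hxy : y ≠ x) (hxK : ∀ p, x ∉ K p) (hyK : ∀ p, y ∉ K p) (hd : a.degree y = a.degree x) :
    Forest H (Function.update K (some x) (y :: K (some x)))
      { a with
        mark := Function.update a.mark y false
        degree := Function.update a.degree x (a.degree x + 1) } none := by
  have hbound : ∀ p, ∀ c ∈ K p, a.bound none c ≤ Aux.bound { a with
        mark := Function.update a.mark y false
        degree := Function.update a.degree x (a.degree x + 1) } none c := by
    intro p c hc
    have h1 : c ≠ x := by rintro rfl; exact hxK p hc
    have h2 : c ≠ y := by rintro rfl; exact hyK p hc
    simp [Aux.bound, h1, h2]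
  have hmem : ∀ p, ∀ v ∈ Function.update K (some x) (y :: K (some x)) p,
      v ∈ K p ∨ v = y ∧ p = some x := by
    intro p v hv
    by_cases hp : p = some x
    · subst hp
      rw [Function.update_self] at hv
      rcases List.mem_cons.1 hv with h | h
      · exact .inr ⟨h, rfl⟩
      · exact .inl h
    · rw [Function.update_of_ne hp] at hv
      exact .inl hv
  refine ⟨?_, ?_, ?_, ?_, ?_⟩
  · obtain ⟨ht, hht⟩ := h.rank
    -- Raising the rank of `x` above that of `y` violates no condition, because `x` is not a child
    -- of any node.
    refine ⟨Function.update ht x (max (ht x) (ht y + 1)), fun u v hv => ?_⟩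
    rcases hmem _ v hv with hv' | ⟨rfl, hu⟩
    · have h1 : v ≠ x := by rintro rfl; exact hxK _ hv'
      rw [Function.update_of_ne h1]
      by_cases hu : u = x
      · subst hu
        have := hht _ _ hv'
        simp [this]
      · rw [Function.update_of_ne hu]
        exact hht _ _ hv'
    · obtain rfl := Option.some.inj hu
      rw [Function.update_of_ne hxy]
      simp
  · intro p v hv
    rcases hmem _ v hv with hv | ⟨rfl, hu⟩
    · exact h.mem _ _ hv
    · exact hy
  · intro u v hv
    rcases hmem _ v hv with hv | ⟨rfl, hu⟩
    · exact h.mem_parent _ _ hv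
    · obtain rfl := Option.some.inj hu
      exact hx
  · intro v hv
    by_cases hvx : v = x
    · subst hvx
      simp [h.degree v hv]
    · simp [hvx, h.degree v hv]
  · intro u
    by_cases hu : u = x
    · subst hu
      rw [Function.update_self]
      refine ⟨?_, (h.fit u).mono fun c hc => hbound _ c hc⟩
      -- The older siblings of the new child are as many as the old degree of `x`, which equals the
      -- degree of `y`.
      simp [Aux.bound, hxy, hd, h.degree u hx]
    · rw [Function.update_of_ne (by simpa using hu)]
      exact (h.fit u).mono fun c hc => hbound _ c hc

theorem wp_link (h : Holds m H K a) {x y : Node Q A} (hx : x ∈ H) (hyK : ∀ p, y ∉ K p) :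
    wp (link y x) m k fun _ m' k' => k' ≤ k + 10 ∧
      Holds m' H (Function.update K (some x) (y :: K (some x))) { a with
        mark := Function.update a.mark y false
        degree := Function.update a.degree x (a.degree x + 1) } := by
  rw [link, wp_bind]
  refine (wp_push h (fun u hu => Option.some.inj hu ▸ hx) hyK).mono ?_
  rintro _ m' k' ⟨hk, h'⟩
  simp only [wp_bind, wp_write, wp_read, wp_compute]
  refine ⟨by omega, h'.of_eq (by simp) ?_⟩
  have := h'.degree x
  simp [h'.aux, this]

/-- The trees whose roots are the elements of `T` are in the slots for their degrees. -/
structure Slots (H : Finset (Node Q A)) (K : Option (Node Q A) → List (Node Q A)) (a : Aux Q A)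
    (T : Finset (Node Q A)) : Prop where
  mem : ∀ v ∈ T, v ∈ H
  root : ∀ v ∈ T, ∀ p, v ∉ K p
  slot : ∀ v ∈ T, a.slot (a.degree v) = some v
  sound : ∀ d ≤ FinEnum.card (Node Q A), ∀ v, a.slot d = some v → v ∈ T ∧ a.degree v = d

variable {T : Finset (Node Q A)}

theorem Slots.erase (h : Slots H K a T) {y : Node Q A} (hy : y ∈ T) :
    Slots H K { a with slot := Function.update a.slot (a.degree y) none } (T.erase y) where
  mem v hv := h.mem v (Finset.mem_of_mem_erase hv)
  root v hv := h.root v (Finset.mem_of_mem_erase hv)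
  slot v hv := by
    have h1 := h.slot v (Finset.mem_of_mem_erase hv)
    have h2 : a.degree v ≠ a.degree y := by
      intro h3
      rw [h3, h.slot y hy] at h1
      exact Finset.ne_of_mem_erase hv (Option.some.inj h1).symm
    simpa [h2] using h1
  sound d hd v hv := by
    by_cases h1 : d = a.degree y
    · simp [h1] at hv
    · simp only [Function.update_of_ne h1] at hv
      obtain ⟨h2, h3⟩ := h.sound d hd v hv
      refine ⟨Finset.mem_erase.2 ⟨?_, h2⟩, h3⟩
      rintro rfl
      exact h1 h3.symm

theorem Slots.insert (h : Slots H K a T) {x : Node Q A} (hx : x ∈ H) (hxK : ∀ p, x ∉ K p)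
    (hs : a.slot (a.degree x) = none) :
    Slots H K { a with slot := Function.update a.slot (a.degree x) (some x) }
      (Insert.insert x T) where
  mem v hv := by
    rcases Finset.mem_insert.1 hv with rfl | hv
    · exact hx
    · exact h.mem v hv
  root v hv := by
    rcases Finset.mem_insert.1 hv with rfl | hv
    · exact hxK
    · exact h.root v hv
  slot v hv := by
    rcases Finset.mem_insert.1 hv with rfl | hv
    · simp
    · have h1 := h.slot v hv
      have h2 : a.degree v ≠ a.degree x := by
        intro h3
        rw [h3, hs] at h1
        cases h1
      simpa [h2] using h1
  sound d hd v hv := by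
    by_cases h1 : d = a.degree x
    · simp [h1] at hv
      simp [h1, hv]
    · simp only [Function.update_of_ne h1] at hv
      obtain ⟨h2, h3⟩ := h.sound d hd v hv
      exact ⟨Finset.mem_insert_of_mem h2, h3⟩

theorem Slots.link (h : Slots H K a T) {x y : Node Q A} (hx : x ∉ T) (hy : y ∉ T) :
    Slots H (Function.update K (some x) (y :: K (some x))) { a with
        mark := Function.update a.mark y false
        degree := Function.update a.degree x (a.degree x + 1) } T where
  mem := h.mem
  root v hv p := by
    have h1 : v ≠ y := by rintro rfl; exact hy hv
    by_cases hp : p = some x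
    · subst hp
      simp [h1, h.root v hv]
    · simp [hp, h.root v hv]
  slot v hv := by
    have h1 : v ≠ x := by rintro rfl; exact hx hv
    simpa [h1] using h.slot v hv
  sound d hd v hv := by
    obtain ⟨h2, h3⟩ := h.sound d hd v hv
    have h1 : v ≠ x := by rintro rfl; exact hx h2
    exact ⟨h2, by simpa [h1] using h3⟩

/-- The outcome of the part of the consolidation that puts the trees with roots in `T` and in `s`
into the slots. -/
structure Gathered (H : Finset (Node Q A)) (K : Option (Node Q A) → List (Node Q A)) (a : Aux Q A)
    (T s : Finset (Node Q A)) (K' : Option (Node Q A) → List (Node Q A)) (a' : Aux Q A)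
    (T' : Finset (Node Q A)) : Prop where
  forest : Forest H K' a' none
  ordered : Ordered K' a'
  slots : Slots H K' a' T'
  listed : ∀ v, (v ∈ s ∨ v ∈ T ∨ ∃ p, v ∈ K p) → v ∈ T' ∨ ∃ p, v ∈ K' p
  mark : ∀ v, a'.mark v = true → a.mark v = true
  minRoot : a'.minRoot = a.minRoot
  dist : a'.dist = a.dist
  status : a'.status = a.status
  pred : a'.pred = a.pred

/-- Every tree in a slot carries a credit of 16. A round that links takes 6 steps and 10 for `link`,
and is paid by the credit of the tree that it removes from its slot. The last round takes 3 steps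
and leaves a tree with a new credit. The clause on degrees lets `wp_gather` bound them by a running
maximum. -/
theorem wp_place {x : Node Q A} (h : Holds m H K a) (hf : Forest H K a none) (ho : Ordered K a)
    (hs : Slots H K a T) (hx : x ∈ H) (hxT : x ∉ T) (hxK : ∀ p, x ∉ K p) :
    wp (place x) m k fun d m' k' => ∃ K' a' T', Holds m' H K' a' ∧ Gathered H K a T {x} K' a' T' ∧
      K' none = K none ∧ (∀ v ∈ T', a'.degree v = d ∨ v ∈ T ∧ a'.degree v = a.degree v) ∧
      Nat.fib (d + 2) ≤ FinEnum.card (Node Q A) ∧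
      k' + 16 * T'.card ≤ k + 3 + 16 * (T.card + 1) := by
  induction T using Finset.strongInduction generalizing m k K a x with
  | H T ih =>
  have hfib := hf.fib_degree_le h.links hx
  have hcard := lt_of_fib_le hfib
  have hslot : m (.slot (m (.degree x))) = a.slot (a.degree x) := by rw [h.slot, h.degree]
  rw [place]
  simp only [wp_bind, wp_read, hslot]
  cases ho' : a.slot (a.degree x) with
  | none =>
    simp only [wp_bind, wp_write, wp_pure]
    refine ⟨K, { a with slot := Function.update a.slot (a.degree x) (some x) },
      Insert.insert x T, h.of_eq (by simp) (by simp [h.aux, h.degree]),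
      ⟨⟨hf.rank, hf.mem, hf.mem_parent, hf.degree, hf.fit⟩, ho, hs.insert hx hxK ho', ?_,
        fun v hv => hv, rfl, rfl, rfl, rfl⟩, rfl, ?_, ?_, ?_⟩
    · intro v hv
      simpa [or_assoc] using hv
    · intro v hv
      rcases Finset.mem_insert.1 hv with rfl | hv
      · exact .inl (h.degree v).symm
      · exact .inr ⟨hv, rfl⟩
    · rw [h.degree]; exact hfib
    · rw [Finset.card_insert_of_notMem hxT]
  | some y =>
    obtain ⟨hyT, hyd⟩ := hs.sound _ hcard.le y ho'
    have hyx : y ≠ x := by rintro rfl; exact hxT hyT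
    have hyK := hs.root y hyT
    have hy := hs.mem y hyT
    have hs1 := hs.erase hyT
    have hcardT : (T.erase y).card + 1 = T.card := Finset.card_erase_add_one hyT
    set m1 := Function.update m (.slot (m (.degree x))) none with hm1
    have h1 : Holds m1 H K { a with slot := Function.update a.slot (a.degree y) none } :=
      h.of_eq (by simp [hm1]) (by simp [hm1, h.aux, h.degree, hyd])
    have hf1 : Forest H K { a with slot := Function.update a.slot (a.degree y) none } none :=
      ⟨hf.rank, hf.mem, hf.mem_parent, hf.degree, hf.fit⟩
    simp only [wp_bind, wp_write, wp_read, wp_compute]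
    -- the tree with root `c` becomes a child of `b`
    have key : ∀ b c, b ∈ H → c ∈ H → c ≠ b → (∀ p, b ∉ K p) → (∀ p, c ∉ K p) →
        b ∉ T.erase y → c ∉ T.erase y →
        a.degree c = a.degree b → a.dist b ≤ a.dist c → (b = x ∨ c = x) → (b = y ∨ c = y) →
        wp (link c b) m1 (k + 1 + 1 + 1 + 1 + 1 + 1) fun _ m' k' => wp (place b) m' k'
          fun d m' k' => ∃ K' a' T', Holds m' H K' a' ∧ Gathered H K a T {x} K' a' T' ∧
            K' none = K none ∧ (∀ v ∈ T', a'.degree v = d ∨ v ∈ T ∧ a'.degree v = a.degree v) ∧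
            Nat.fib (d + 2) ≤ FinEnum.card (Node Q A) ∧
            k' + 16 * T'.card ≤ k + 3 + 16 * (T.card + 1) := by
      intro b c hb hc hcb hbK hcK hbT hcT hd hdist hx' hy'
      refine (wp_link h1 hb hcK).mono ?_
      rintro _ m2 k2 ⟨hk2, h2⟩
      have hbK' : ∀ p, b ∉ Function.update K (some b) (c :: K (some b)) p := by
        intro p
        by_cases hp : p = some b
        · subst hp; simp [hcb.symm, hbK]
        · simp [hp, hbK]
      refine (ih (T.erase y) (Finset.erase_ssubset hyT) h2 (hf1.link hb hc hcb hbK hcK hd) ?_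
        (hs1.link hbT hcT) hb hbT hbK').mono ?_
      · intro u v hv
        by_cases hu : u = b
        · subst hu
          rw [Function.update_self] at hv
          rcases List.mem_cons.1 hv with hv | hv
          · rw [hv]; exact hdist
          · exact ho _ _ hv
        · rw [Function.update_of_ne (by simpa using hu)] at hv
          exact ho _ _ hv
      · rintro d m3 k3 ⟨K3, a3, T3, h3, hg, hK3, hdeg, hfib3, hk3⟩
        refine ⟨K3, a3, T3, h3, ⟨hg.forest, hg.ordered, hg.slots, ?_, ?_, hg.minRoot, hg.dist,
          hg.status, hg.pred⟩, ?_, ?_, hfib3, by omega⟩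
        · intro v hv
          refine hg.listed v ?_
          have : ∀ p, v ∈ K p → ∃ p, v ∈ Function.update K (some b) (c :: K (some b)) p := by
            intro p hp
            refine ⟨p, ?_⟩
            by_cases hpb : p = some b
            · subst hpb; simp [hp]
            · simpa [hpb] using hp
          by_cases hvb : v = b
          · exact .inl (by simp [hvb])
          by_cases hvc : v = c
          · exact .inr (.inr ⟨some b, by simp [hvc]⟩)
          rcases hv with hv | hv | ⟨p, hp⟩
          · rw [Finset.mem_singleton] at hv
            subst hv
            rcases hx' with h | h
            · exact absurd h.symm hvb
            · exact absurd h.symm hvc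
          · refine .inr (.inl (Finset.mem_erase.2 ⟨?_, hv⟩))
            rintro rfl
            rcases hy' with h | h
            · exact absurd h.symm hvb
            · exact absurd h.symm hvc
          · exact .inr (.inr (this p hp))
        · intro v hv
          have := hg.mark v hv
          by_cases hvc : v = c
          · simp [hvc] at this
          · simpa [hvc] using this
        · rw [hK3]; simp
        · intro v hv
          rcases hdeg v hv with hv | ⟨hv1, hv2⟩
          · exact .inl hv
          · refine .inr ⟨Finset.mem_of_mem_erase hv1, ?_⟩
            have : v ≠ b := by rintro rfl; exact hbT hv1
            simpa [this] using hv2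
    have hxe : x ∉ T.erase y := fun h => hxT (Finset.mem_of_mem_erase h)
    have hkx : m1 (.dist x) = a.dist x := h1.dist x
    have hky : m1 (.dist y) = a.dist y := h1.dist y
    rw [← hm1, hkx, hky]
    by_cases hlt : a.dist y < a.dist x
    · simp only [hlt, decide_true, if_true, wp_bind]
      exact key y x hy hx hyx.symm hyK hxK (by simp) hxe hyd.symm hlt.le (.inr rfl) (.inl rfl)
    · simp only [hlt, decide_false, Bool.false_eq_true, if_false, wp_bind]
      exact key x y hx hy hyx hxK hyK hxe (by simp) hyd (not_lt.1 hlt) (.inl rfl) (.inr rfl)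

end Consolidate

/-! ### Deleting the minimum -/

section DeleteMin

set_option linter.unusedSectionVars false

variable {Q A : Type} [FinEnum Q] [FinEnum A] {m : Region Q A} {k : ℕ} {H : Finset (Node Q A)}
  {K : Option (Node Q A) → List (Node Q A)} {a : Aux Q A} {T : Finset (Node Q A)}

/-- Each root costs 1 step for reading, 5 for `unlink`, 3 + 16 for `place` with the new credit, and
1 for the maximum, which makes 26. -/
theorem wp_gather {l : List (Node Q A)} {top : ℕ} (hl : K none = l) (h : Holds m H K a)
    (hf : Forest H K a none) (ho : Ordered K a) (hs : Slots H K a T)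
    (htop : Nat.fib (top + 2) ≤ FinEnum.card (Node Q A)) (hT : ∀ v ∈ T, a.degree v ≤ top) :
    wp (gather top) m k fun d m' k' => ∃ K' a' T', Holds m' H K' a' ∧ Gathered H K a T ∅ K' a' T' ∧
      K' none = [] ∧ (∀ v ∈ T', a'.degree v ≤ d) ∧
      Nat.fib (d + 2) ≤ FinEnum.card (Node Q A) ∧
      k' + 16 * T'.card ≤ k + 1 + 26 * l.length + 16 * T.card := by
  induction l generalizing m k K a T top with
  | nil =>
    have hfirst : m (.first none) = none := by
      have := h.links.first_none
      rwa [hl] at this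
    rw [gather]
    simp only [wp_bind, wp_read, hfirst, wp_pure]
    refine ⟨K, a, T, h, ⟨hf, ho, hs, ?_, fun v hv => hv, rfl, rfl, rfl, rfl⟩, hl, hT, htop, by simp⟩
    intro v hv
    simpa using hv
  | cons w l ih =>
    have hfirst : m (.first none) = some w := by
      have := h.links.first_none
      rwa [hl] at this
    rw [gather]
    simp only [wp_bind, wp_read, hfirst]
    have hw : w ∈ K none := by simp [hl]
    refine (wp_unlink h (l₁ := []) hl).mono ?_
    rintro _ m1 k1 ⟨hk1, h1⟩
    simp only [List.nil_append] at h1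
    have hnd := h.links.nodup none
    rw [hl, List.nodup_cons] at hnd
    have hmem1 : ∀ p, ∀ v ∈ Function.update K none l p, v ∈ K p := by
      intro p v hv
      by_cases hp : p = none
      · subst hp
        rw [Function.update_self] at hv
        simp [hl, hv]
      · rwa [Function.update_of_ne hp] at hv
    have hf1 : Forest H (Function.update K none l) a none :=
      hf.of_roots (by simp) fun v hv => hf.mem _ _ (hmem1 _ v hv)
    have ho1 : Ordered (Function.update K none l) a := fun u v hv => ho u v (hmem1 _ _ hv)
    have hs1 : Slots H (Function.update K none l) a T :=
      ⟨hs.mem, fun v hv p hp => hs.root v hv p (hmem1 _ _ hp), hs.slot, hs.sound⟩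
    have hwK : ∀ p, w ∉ Function.update K none l p := by
      intro p hp
      obtain rfl := h.links.unique (hmem1 _ _ hp) hw
      rw [Function.update_self] at hp
      exact hnd.1 hp
    refine (wp_place h1 hf1 ho1 hs1 (hf.mem _ _ hw) (fun hT => hs.root w hT _ hw) hwK).mono ?_
    rintro d m2 k2 ⟨K2, a2, T2, h2, hg2, hK2, hdeg2, hfib2, hk2⟩
    rw [Function.update_self] at hK2
    simp only [wp_compute]
    have hfib : Nat.fib (max top d + 2) ≤ FinEnum.card (Node Q A) := by
      rcases max_choice top d with h | h <;> rw [h] <;> assumption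
    refine (ih (top := max top d) hK2 h2 hg2.forest hg2.ordered hg2.slots hfib ?_).mono ?_
    · intro v hv
      rcases hdeg2 v hv with h | ⟨h3, h4⟩
      · simp [h]
      · rw [h4]
        exact le_max_of_le_left (hT v h3)
    · rintro d' m3 k3 ⟨K3, a3, T3, h3, hg3, hK3, hdeg3, hfib3, hk3⟩
      refine ⟨K3, a3, T3, h3, ⟨hg3.forest, hg3.ordered, hg3.slots, ?_, ?_,
        hg3.minRoot.trans hg2.minRoot, hg3.dist.trans hg2.dist, hg3.status.trans hg2.status,
        hg3.pred.trans hg2.pred⟩, hK3, hdeg3, hfib3, ?_⟩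
      · intro v hv
        refine hg3.listed v (.inr (hg2.listed v ?_))
        rcases hv with hv | hv | ⟨p, hp⟩
        · simp at hv
        · exact .inr (.inl hv)
        · by_cases hvw : v = w
          · simp [hvw]
          · refine .inr (.inr ⟨p, ?_⟩)
            by_cases hpn : p = none
            · subst hpn
              rw [hl] at hp
              simpa [hvw] using hp
            · simpa [hpn] using hp
      · exact fun v hv => hg2.mark v (hg3.mark v hv)
      · simp only [List.length_cons]
        omega

/-- That an existing pointer moves only for a strictly smaller key matters in `wp_decreaseKey`,
where `v` need not be a root. -/
theorem wp_updateMin (h : Holds m H K a) (v : Node Q A) :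
    wp (updateMin v) m k fun _ m' k' => ∃ r, Holds m' H K { a with minRoot := some r } ∧
      (a.minRoot = some r ∨ r = v ∧ ∀ u, a.minRoot = some u → a.dist v < a.dist u) ∧
      a.dist r ≤ a.dist v ∧ (∀ u, a.minRoot = some u → a.dist r ≤ a.dist u) ∧ k' ≤ k + 5 := by
  rw [updateMin]
  simp only [wp_bind, wp_read, h.minRoot]
  cases hm : a.minRoot with
  | none =>
    simp only [wp_write]
    exact ⟨v, h.of_eq (by simp) (by simp [h.aux]), .inr ⟨rfl, by simp⟩, le_rfl, by simp, by omega⟩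
  | some u =>
    have hku : m (.dist u) = a.dist u := h.dist u
    have hkv : m (.dist v) = a.dist v := h.dist v
    simp only [wp_bind, wp_read, wp_compute]
    rw [hku, hkv]
    by_cases hlt : a.dist v < a.dist u
    · simp only [hlt, decide_true, if_true, wp_write]
      exact ⟨v, h.of_eq (by simp) (by simp [h.aux]), .inr ⟨rfl, by simpa using hlt⟩, le_rfl,
        by simpa using hlt.le, by omega⟩
    · simp only [hlt, decide_false, Bool.false_eq_true, if_false, wp_pure]
      refine ⟨u, h.of_eq rfl (by rw [h.aux, ← hm]), .inl rfl, not_lt.1 hlt, by simp, by omega⟩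

/-- A Fibonacci heap between two operations. -/
structure IsHeap (H : Finset (Node Q A)) (K : Option (Node Q A) → List (Node Q A))
    (a : Aux Q A) : Prop where
  forest : Forest H K a none
  ordered : Ordered K a
  listed : ∀ v ∈ H, ∃ p, v ∈ K p
  slot : ∀ d ≤ FinEnum.card (Node Q A), a.slot d = none
  minRoot_mem : ∀ r, a.minRoot = some r → r ∈ K none
  minRoot_le : ∀ v ∈ H, ∃ r, a.minRoot = some r ∧ a.dist r ≤ a.dist v

/-- In a forest that respects the order, the least root is the least node. -/
theorem Forest.minRoot_le {w : Option (Node Q A)} (h : Forest H K a w) (ho : Ordered K a)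
    (hl : ∀ v ∈ H, ∃ p, v ∈ K p)
    (hr : ∀ v ∈ K none, ∃ r, a.minRoot = some r ∧ a.dist r ≤ a.dist v) :
    ∀ v ∈ H, ∃ r, a.minRoot = some r ∧ a.dist r ≤ a.dist v := by
  obtain ⟨ht, hht⟩ := h.rank
  -- Passing to the parent raises the rank, so the distance to the maximal rank decreases until a
  -- root is reached.
  have key : ∀ n, ∀ v ∈ H, Finset.univ.sup ht - ht v ≤ n →
      ∃ r, a.minRoot = some r ∧ a.dist r ≤ a.dist v := by
    intro n
    induction n with
    | zero =>
      intro v hv hn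
      obtain ⟨_ | u, hp⟩ := hl v hv
      · exact hr v hp
      · have h1 := hht u v hp
        have h2 : ht u ≤ Finset.univ.sup ht := Finset.le_sup (Finset.mem_univ u)
        omega
    | succ n ih =>
      intro v hv hn
      obtain ⟨_ | u, hp⟩ := hl v hv
      · exact hr v hp
      · have h1 := hht u v hp
        have h2 : ht u ≤ Finset.univ.sup ht := Finset.le_sup (Finset.mem_univ u)
        obtain ⟨r, h3, h4⟩ := ih u (h.mem_parent u v hp) (by omega)
        exact ⟨r, h3, h4.trans (ho u v hp)⟩
  exact fun v hv => key _ v hv le_rfl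

/-- The condition that the pointer to the minimum satisfies with respect to the root list. -/
def LeastRoot (K : Option (Node Q A) → List (Node Q A)) (a : Aux Q A) : Prop :=
  (∀ v ∈ K none, ∃ r, a.minRoot = some r ∧ a.dist r ≤ a.dist v) ∧
    ∀ r, a.minRoot = some r → r ∈ K none

theorem wp_push_updateMin {m : Region Q A} (h : Holds m H K a) {x : Node Q A}
    (hx : ∀ p, x ∉ K p) (hr : LeastRoot K a) :
    wp (push none x) m k fun _ m' k' => wp (updateMin x) m' k' fun _ m' k' =>
      ∃ r, Holds m' H (Function.update K none (x :: K none)) { a with minRoot := r } ∧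
        LeastRoot (Function.update K none (x :: K none)) { a with minRoot := r } ∧
        k' ≤ k + 11 := by
  refine (wp_push h (by simp) hx).mono ?_
  rintro _ m1 k1 ⟨hk1, h1⟩
  refine (wp_updateMin h1 x).mono ?_
  rintro _ m2 k2 ⟨r, h2, hor, hrx, hru, hk2⟩
  refine ⟨some r, h2, ⟨?_, ?_⟩, by omega⟩
  · intro v hv
    refine ⟨r, rfl, ?_⟩
    rw [Function.update_self] at hv
    rcases List.mem_cons.1 hv with hv | hv
    · rw [hv]; exact hrx
    · obtain ⟨r', h3, h4⟩ := hr.1 v hv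
      exact (hru r' h3).trans h4
  · intro r' hr'
    obtain rfl := Option.some.inj hr'
    rw [Function.update_self]
    rcases hor with h3 | ⟨h3, -⟩
    · exact List.mem_cons_of_mem _ (hr.2 r h3)
    · simp [h3]

/-- The state of affairs while the slots are emptied, after those below `i`. -/
structure Emptying (H : Finset (Node Q A)) (K : Option (Node Q A) → List (Node Q A)) (a : Aux Q A)
    (T : Finset (Node Q A)) (i top : ℕ) : Prop where
  forest : Forest H K a none
  ordered : Ordered K a
  slots : Slots H K a T
  listed : ∀ v ∈ H, v ∈ T ∨ ∃ p, v ∈ K p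
  degree : ∀ v ∈ T, i ≤ a.degree v ∧ a.degree v ≤ top
  least : LeastRoot K a
  length : (K none).length ≤ i

/-- Each slot holds at most one tree, so at most `degBound + 1` roots remain. The old roots cost 26
steps each, which the potential will pay for. Emptying a slot costs 13: 2 for reading and clearing
it, 6 for `push`, 5 for `updateMin`. -/
theorem wp_consolidate (h : Holds m H K a) (hf : Forest H K a none) (ho : Ordered K a)
    (hl : ∀ v ∈ H, ∃ p, v ∈ K p) (hs : ∀ d ≤ FinEnum.card (Node Q A), a.slot d = none)
    (hn : 1 ≤ FinEnum.card (Node Q A)) :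
    wp consolidate m k fun _ m' k' => ∃ K' a', Holds m' H K' a' ∧ IsHeap H K' a' ∧
      (∀ v, a'.mark v = true → a.mark v = true) ∧ a'.dist = a.dist ∧ a'.status = a.status ∧
      a'.pred = a.pred ∧ (K' none).length ≤ degBound (FinEnum.card (Node Q A)) + 1 ∧
      k' ≤ k + 2 + 26 * (K none).length +
        13 * (degBound (FinEnum.card (Node Q A)) + 1) := by
  rw [consolidate]
  simp only [wp_bind, wp_write]
  have h0 : Holds (Function.update m .minRoot none) H K { a with minRoot := none } :=
    h.of_eq (by simp) (by simp [h.aux])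
  refine (wp_gather (T := ∅) (top := 0) rfl h0
    ⟨hf.rank, hf.mem, hf.mem_parent, hf.degree, hf.fit⟩ ho
    ⟨by simp, by simp, by simp, fun d hd v hv => by simp [hs d hd] at hv⟩ (by simpa using hn)
    (by simp)).mono ?_
  rintro top m1 k1 ⟨K1, a1, T1, h1, hg1, hK1, hdeg1, hfib1, hk1⟩
  have htop := le_degBound hfib1
  have hcard := lt_of_fib_le hfib1
  refine (wp_forM_range (fun i m' k' => ∃ K' a' T', Holds m' H K' a' ∧
    Emptying H K' a' T' i top ∧ a'.mark = a1.mark ∧ a'.dist = a1.dist ∧ a'.status = a1.status ∧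
    a'.pred = a1.pred ∧ k' ≤ k1 + 13 * i) ?_ ?_).mono ?_
  · refine ⟨K1, a1, T1, h1, ⟨hg1.forest, hg1.ordered, hg1.slots, ?_, ?_, ⟨?_, ?_⟩, ?_⟩, rfl, rfl, rfl,
      rfl, by omega⟩
    · exact fun v hv => hg1.listed v (.inr (.inr (hl v hv)))
    · exact fun v hv => ⟨by omega, hdeg1 v hv⟩
    · simp [hK1]
    · simp [hg1.minRoot]
    · simp [hK1]
  · rintro i m2 k2 hi ⟨K2, a2, T2, h2, he, hmark, hdist, hstatus, hpred, hk2⟩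
    simp only [wp_bind, wp_read, h2.slot]
    cases hsl : a2.slot i with
    | none =>
      simp only [wp_pure]
      refine ⟨K2, a2, T2, h2, ⟨he.forest, he.ordered, he.slots, he.listed, fun v hv => ?_, he.least,
        by have := he.length; omega⟩, hmark, hdist, hstatus, hpred, by omega⟩
      have h3 := he.degree v hv
      have h4 := he.slots.slot v hv
      have : a2.degree v ≠ i := by
        intro h5
        rw [h5, hsl] at h4
        cases h4
      omega
    | some x =>
      obtain ⟨hxT, rfl⟩ := he.slots.sound i (by omega) x hsl
      have hxK := he.slots.root x hxT
      have h3 : Holds (Function.update m2 (.slot (a2.degree x)) none) H K2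
          { a2 with slot := Function.update a2.slot (a2.degree x) none } :=
        h2.of_eq (by simp) (by simp [h2.aux])
      have hs3 := he.slots.erase hxT
      simp only [wp_bind, wp_write]
      refine (wp_push_updateMin h3 hxK he.least).mono fun _ m4 k4 h => h.mono ?_
      rintro _ m5 k5 ⟨r, h5, hleast, hk5⟩
      refine ⟨_, _, T2.erase x, h5, ⟨?_, ?_, ⟨hs3.mem, ?_, hs3.slot, hs3.sound⟩, ?_, ?_, hleast, ?_⟩,
        hmark, hdist, hstatus, hpred, by omega⟩
      · have : Forest H K2 { a2 with
            slot := Function.update a2.slot (a2.degree x) none, minRoot := r } none :=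
          ⟨he.forest.rank, he.forest.mem, he.forest.mem_parent, he.forest.degree, he.forest.fit⟩
        refine this.of_roots (by simp) ?_
        rw [Function.update_self]
        intro v hv
        rcases List.mem_cons.1 hv with rfl | hv
        · exact he.slots.mem _ hxT
        · exact he.forest.mem _ _ hv
      · intro u v hv
        rw [Function.update_of_ne (by simp)] at hv
        exact he.ordered u v hv
      · intro v hv p
        have h6 := Finset.mem_erase.1 hv
        rcases p with _ | u
        · simp [h6.1, hs3.root v hv]
        · simpa using hs3.root v hv (some u)
      · intro v hv
        by_cases hvx : v = x
        · exact .inr ⟨none, by simp [hvx]⟩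
        · rcases he.listed v hv with h6 | ⟨_ | u, hp⟩
          · exact .inl (Finset.mem_erase.2 ⟨hvx, h6⟩)
          · exact .inr ⟨none, by simp [hp]⟩
          · exact .inr ⟨some u, by simpa using hp⟩
      · intro v hv
        have h6 := Finset.mem_erase.1 hv
        have h7 := he.degree v h6.2
        have h8 := he.slots.slot v h6.2
        have : a2.degree v ≠ a2.degree x := by
          intro h9
          rw [h9, hsl] at h8
          exact h6.1 (Option.some.inj h8).symm
        show a2.degree x + 1 ≤ a2.degree v ∧ a2.degree v ≤ top
        omega
      · simp only [Function.update_self, List.length_cons]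
        have := he.length
        omega
  · rintro _ m2 k2 ⟨K2, a2, T2, h2, he, hmark, hdist, hstatus, hpred, hk2⟩
    have hT2 : ∀ v, v ∉ T2 := fun v hv => by
      have := he.degree v hv
      omega
    have hl2 : ∀ v ∈ H, ∃ p, v ∈ K2 p := fun v hv => (he.listed v hv).resolve_left (hT2 v)
    refine ⟨K2, a2, h2, ⟨he.forest, he.ordered, hl2, ?_, he.least.2,
      he.forest.minRoot_le he.ordered hl2 he.least.1⟩, ?_, hdist.trans hg1.dist,
      hstatus.trans hg1.status, hpred.trans hg1.pred, he.length.trans (by omega), ?_⟩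
    · intro d hd
      by_contra hne
      obtain ⟨v, hv⟩ := Option.ne_none_iff_exists'.1 hne
      exact hT2 v (he.slots.sound d hd v hv).1
    · intro v hv
      rw [hmark] at hv
      exact hg1.mark v hv
    · simp only [Finset.card_empty] at hk1
      have : 13 * (top + 1) ≤ 13 * (degBound (FinEnum.card (Node Q A)) + 1) := by omega
      omega

/-- A child costs 1 + 5 + 6 steps. Pushing at the front reverses the order, and the degree of `z`
may become wrong since `z` is leaving the heap. -/
theorem wp_releaseChildren {z : Node Q A} (h : Holds m H K a) (hz : z ∈ H) (l : List (Node Q A))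
    (hl : K (some z) = l) :
    wp (releaseChildren z) m k fun _ m' k' =>
      Holds m' H (Function.update (Function.update K none (l.reverse ++ K none)) (some z) []) a ∧
        k' ≤ k + 1 + 12 * l.length := by
  induction l generalizing m k K with
  | nil =>
    have hfirst : m (.first (some z)) = none := by
      have := h.links.first_some z hz
      rwa [hl] at this
    rw [releaseChildren]
    simp only [wp_bind, wp_read, hfirst, wp_pure]
    refine ⟨?_, by simp⟩
    convert h using 1
    funext p
    rcases p with _ | u
    · simp
    · by_cases hu : u = z
      · simp [hu, hl]
      · simp [hu]
  | cons w l ih =>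
    have hfirst : m (.first (some z)) = some w := by
      have := h.links.first_some z hz
      rwa [hl] at this
    rw [releaseChildren]
    simp only [wp_bind, wp_read, hfirst]
    have hw : w ∈ K (some z) := by simp [hl]
    refine (wp_unlink h (l₁ := []) hl).mono ?_
    rintro _ m1 k1 ⟨hk1, h1⟩
    simp only [List.nil_append] at h1
    have hnd := h.links.nodup (some z)
    rw [hl, List.nodup_cons] at hnd
    have hwK : ∀ p, w ∉ Function.update K (some z) l p := by
      intro p hp
      by_cases hpz : p = some z
      · subst hpz
        rw [Function.update_self] at hp
        exact hnd.1 hp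
      · rw [Function.update_of_ne hpz] at hp
        exact hpz (h.links.unique hp hw)
    refine (wp_push h1 (by simp) hwK).mono ?_
    rintro _ m2 k2 ⟨hk2, h2⟩
    refine (ih h2 (by simp)).mono ?_
    rintro _ m3 k3 ⟨h3, hk3⟩
    refine ⟨?_, by simp only [List.length_cons]; omega⟩
    convert h3 using 1
    funext p
    rcases p with _ | u
    · simp
    · by_cases hu : u = z
      · simp [hu]
      · simp [hu]

/-- The number of marked nodes. -/
def marks (H : Finset (Node Q A)) (μ : Node Q A → Bool) : ℕ :=
  (H.filter fun v => μ v = true).card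

/-- The potential for the amortised analysis. -/
def potential (H : Finset (Node Q A)) (K : Option (Node Q A) → List (Node Q A)) (a : Aux Q A) : ℕ :=
  26 * ((K none).length + 2 * marks H a.mark)

/-- The amortised number of steps of a deletion. -/
def deleteCost (Q A : Type) [FinEnum Q] [FinEnum A] : ℕ :=
  80 * (degBound (FinEnum.card (Node Q A)) + 1)

theorem marks_mono {H' : Finset (Node Q A)} {μ μ' : Node Q A → Bool} (hH : H' ⊆ H)
    (hμ : ∀ v, μ' v = true → μ v = true) : marks H' μ' ≤ marks H μ :=
  Finset.card_le_card fun v hv => by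
    rw [Finset.mem_filter] at hv ⊢
    exact ⟨hH hv.1, hμ v hv.2⟩

/-- Let D be the degree bound. The old roots are consolidated at the expense of the old potential.
What remains is at most 12 + 26 steps for each of the at most D children of `z`, 13 steps and 26
units of new potential for each of D + 1 slots, and a constant. -/
theorem wp_deleteMin {z : Node Q A} (h : Holds m H K a) (hh : IsHeap H K a) (hz : z ∈ K none) :
    wp (deleteMin z) m k fun _ m' k' => ∃ K' a', Holds m' (H.erase z) K' a' ∧
      IsHeap (H.erase z) K' a' ∧ a'.dist = a.dist ∧ a'.status = a.status ∧ a'.pred = a.pred ∧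
      k' + potential (H.erase z) K' a' ≤ k + potential H K a + deleteCost Q A := by
  have hf := hh.forest
  have hzH := hf.mem _ _ hz
  obtain ⟨l₁, l₂, hK⟩ := List.append_of_mem hz
  have hnd := h.links.nodup none
  have hdeg := le_degBound (hf.fib_degree_le h.links hzH)
  rw [hf.degree z hzH] at hdeg
  rw [deleteMin, wp_bind]
  refine (wp_unlink h hK).mono ?_
  rintro _ m1 k1 ⟨hk1, h1⟩
  rw [wp_bind]
  refine (wp_releaseChildren h1 hzH (K (some z)) (by simp)).mono ?_
  rintro _ m2 k2 ⟨h2, hk2⟩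
  set K2 := Function.update (Function.update (Function.update K none (l₁ ++ l₂)) none
    ((K (some z)).reverse ++ Function.update K none (l₁ ++ l₂) none)) (some z) [] with hK2
  have hK2none : K2 none = (K (some z)).reverse ++ (l₁ ++ l₂) := by simp [hK2]
  have hK2z : K2 (some z) = [] := by simp [hK2]
  have hK2u : ∀ u, u ≠ z → K2 (some u) = K (some u) := fun u hu => by simp [hK2, hu]
  have hz1 : z ∉ l₁ ++ l₂ := by
    rw [hK] at hnd
    simp [List.nodup_append] at hnd ⊢
    grind
  have hzK : ∀ u, z ∉ K (some u) := fun u hu => by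
    have := h.links.unique hu hz
    cases this
  have hmem : ∀ p, ∀ v ∈ K2 p, v ≠ z ∧ ∃ q, v ∈ K q := by
    rintro (_ | u) v hv
    · rw [hK2none, List.mem_append, List.mem_reverse] at hv
      rcases hv with hv | hv
      · refine ⟨?_, _, hv⟩
        rintro rfl
        exact hzK _ hv
      · refine ⟨?_, none, ?_⟩
        · rintro rfl
          exact hz1 hv
        · rw [hK]
          simp at hv ⊢
          tauto
    · by_cases hu : u = z
      · subst hu
        simp [hK2z] at hv
      · rw [hK2u u hu] at hv
        refine ⟨?_, _, hv⟩
        rintro rfl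
        exact hzK _ hv
  have hsub : ∀ u, ∀ v ∈ K2 (some u), v ∈ K (some u) ∧ u ≠ z := by
    intro u v hv
    by_cases hu : u = z
    · subst hu
      simp [hK2z] at hv
    · exact ⟨hK2u u hu ▸ hv, hu⟩
  have hf2 : Forest (H.erase z) K2 a none := by
    refine ⟨?_, ?_, ?_, ?_, ?_⟩
    · obtain ⟨ht, hht⟩ := hf.rank
      exact ⟨ht, fun u v hv => hht u v (hsub u v hv).1⟩
    · intro p v hv
      obtain ⟨h3, q, h4⟩ := hmem p v hv
      exact Finset.mem_erase.2 ⟨h3, hf.mem q v h4⟩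
    · intro u v hv
      exact Finset.mem_erase.2 ⟨(hsub u v hv).2, hf.mem_parent u v (hsub u v hv).1⟩
    · intro v hv
      rw [Finset.mem_erase] at hv
      rw [hK2u v hv.1]
      exact hf.degree v hv.2
    · intro u
      by_cases hu : u = z
      · subst hu
        rw [hK2z]
        trivial
      · rw [hK2u u hu]
        exact hf.fit u
  have hl2 : ∀ v ∈ H.erase z, ∃ p, v ∈ K2 p := by
    intro v hv
    rw [Finset.mem_erase] at hv
    obtain ⟨_ | u, hp⟩ := hh.listed v hv.2
    · refine ⟨none, ?_⟩
      rw [hK] at hp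
      rw [hK2none]
      simp at hp ⊢
      tauto
    · by_cases hu : u = z
      · subst hu
        refine ⟨none, ?_⟩
        rw [hK2none]
        simp [hp]
      · exact ⟨some u, by rwa [hK2u u hu]⟩
  have : Nonempty (Node Q A) := ⟨z⟩
  refine (wp_consolidate (h2.subset (Finset.erase_subset _ _)) hf2
    (fun u v hv => hh.ordered u v (hsub u v hv).1) hl2 hh.slot FinEnum.card_pos).mono ?_
  rintro _ m3 k3 ⟨K3, a3, h3, hh3, hmark3, hd3, hs3, hp3, hlen3, hk3⟩
  refine ⟨K3, a3, h3, hh3, hd3, hs3, hp3, ?_⟩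
  have hmarks : marks (H.erase z) a3.mark ≤ marks H a.mark :=
    marks_mono (Finset.erase_subset _ _) hmark3
  have hlen : (K2 none).length = (K (some z)).length + (l₁ ++ l₂).length := by
    rw [hK2none]
    simp
  have hlen' : (K none).length = (l₁ ++ l₂).length + 1 := by
    rw [hK]
    simp
    omega
  unfold potential deleteCost
  omega

end DeleteMin

/-! ### Decreasing a key and inserting -/

section DecreaseKey

set_option linter.unusedSectionVars false

variable {Q A : Type} [FinEnum Q] [FinEnum A] {m : Region Q A} {k : ℕ} {H : Finset (Node Q A)}
  {K : Option (Node Q A) → List (Node Q A)} {a : Aux Q A} {w : Option (Node Q A)}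

theorem marks_update_false (μ : Node Q A → Bool) {v : Node Q A} (hv : v ∈ H) (hμ : μ v = true) :
    marks H (Function.update μ v false) + 1 = marks H μ := by
  have : (H.filter fun u => Function.update μ v false u = true) =
      (H.filter fun u => μ u = true).erase v := by
    ext u
    by_cases hu : u = v
    · subst hu; simp
    · simp [hu]
  unfold marks
  rw [this, Finset.card_erase_add_one]
  simp [hv, hμ]

theorem marks_update_true_le (μ : Node Q A → Bool) (v : Node Q A) :
    marks H (Function.update μ v true) ≤ marks H μ + 1 := by
  unfold marks
  refine le_trans (Finset.card_le_card (t := Insert.insert v (H.filter fun u => μ u = true)) ?_)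
    (Finset.card_insert_le _ _)
  intro u hu
  by_cases huv : u = v
  · simp [huv]
  · simpa [huv] using hu

theorem marks_update_false_le (μ : Node Q A → Bool) (v : Node Q A) :
    marks H (Function.update μ v false) ≤ marks H μ := by
  refine marks_mono subset_rfl fun u hu => ?_
  by_cases huv : u = v
  · simp [huv] at hu
  · simpa [huv] using hu

/-- Used for the facts on `List.erase` in `cutLists`. -/
instance : LawfulBEq (Node Q A) where
  rfl := by
    rintro (x | x) <;> exact BEq.rfl (a := x)
  eq_of_beq := by
    rintro (x | x) (y | y) h
    · exact congrArg _ (eq_of_beq (a := x) (b := y) h)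
    · cases h
    · cases h
    · exact congrArg _ (eq_of_beq (a := x) (b := y) h)

/-- The lists after the child `x` has been cut off its parent `y`. -/
def cutLists (K : Option (Node Q A) → List (Node Q A)) (x y : Node Q A) :
    Option (Node Q A) → List (Node Q A) :=
  Function.update (Function.update K (some y) ((K (some y)).erase x)) none (x :: K none)

theorem mem_cutLists_some {x y u v : Node Q A} (h : v ∈ cutLists K x y (some u)) :
    v ∈ K (some u) := by
  rw [cutLists, Function.update_of_ne (by simp)] at h
  by_cases hu : u = y
  · subst hu
    rw [Function.update_self] at h
    exact List.mem_of_mem_erase h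
  · rwa [Function.update_of_ne (by simpa using hu)] at h

theorem mem_cutLists {x y v : Node Q A} {p : Option (Node Q A)} (h : v ∈ K p) :
    ∃ q, v ∈ cutLists K x y q := by
  by_cases hvx : v = x
  · exact ⟨none, by simp [cutLists, hvx]⟩
  · refine ⟨p, ?_⟩
    rcases p with _ | u
    · simp [cutLists, h]
    · by_cases hu : u = y
      · subst hu
        simpa [cutLists, List.mem_erase_of_ne hvx] using h
      · simpa [cutLists, hu] using h

theorem wp_cut (h : Holds m H K a) {x y : Node Q A} (hx : x ∈ K (some y)) :
    wp (cut x y) m k fun _ m' k' => k' ≤ k + 15 ∧ Holds m' H (cutLists K x y)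
      { a with
        degree := Function.update a.degree y (a.degree y - 1)
        mark := Function.update a.mark x false } := by
  obtain ⟨l₁, l₂, hK⟩ := List.append_of_mem hx
  have hnd := h.links.nodup (some y)
  rw [hK] at hnd
  have hx1 : x ∉ l₁ := fun h => by
    simp [List.nodup_append] at hnd
    grind
  have herase : (K (some y)).erase x = l₁ ++ l₂ := by
    rw [hK, List.erase_append_right _ hx1]
    simp
  have hx12 : x ∉ l₁ ++ l₂ := by
    rw [← herase]
    exact (h.links.nodup _).not_mem_erase
  rw [cut]
  simp only [wp_bind]
  refine (wp_unlink h hK).mono ?_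
  rintro _ m1 k1 ⟨hk1, h1⟩
  simp only [wp_read, wp_compute, wp_write, h1.degree]
  have h2 : Holds (Function.update m1 (.degree y) (a.degree y - 1)) H
      (Function.update K (some y) (l₁ ++ l₂))
      { a with degree := Function.update a.degree y (a.degree y - 1) } :=
    h1.of_eq (by simp) (by simp [h1.aux])
  refine (wp_push h2 (p := none) (v := x) (by simp) ?_).mono ?_
  · intro q hq
    by_cases hqy : q = some y
    · subst hqy
      rw [Function.update_self] at hq
      exact hx12 hq
    · rw [Function.update_of_ne hqy] at hq
      exact hqy (h.links.unique hq hx)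
  · rintro _ m3 k3 ⟨hk3, h3⟩
    refine ⟨by omega, ?_⟩
    rw [cutLists, herase]
    exact h3.of_eq (by simp) (by simp [h3.aux])

/-- The parent `y` loses a child before its mark is adjusted, so `y` becomes the exception. A
previous exception `x` lapses, because `x` is now a root and nothing is required of its degree as a
child. -/
theorem Forest.cut (h : Forest H K a w) (hl : Links (ptr m) H K) {x y : Node Q A}
    (hx : x ∈ K (some y)) (hw : w = none ∨ w = some x) :
    Forest H (cutLists K x y)
      { a with
        degree := Function.update a.degree y (a.degree y - 1)
        mark := Function.update a.mark x false } (some y) := by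
  have hy := h.mem_parent y x hx
  have hne : ∀ u, ∀ c ∈ cutLists K x y (some u), c ≠ x := by
    rintro u c hc rfl
    obtain rfl := Option.some.inj (hl.unique (mem_cutLists_some hc) hx)
    rw [cutLists, Function.update_of_ne (by simp), Function.update_self] at hc
    exact (hl.nodup _).not_mem_erase hc
  refine ⟨?_, ?_, ?_, ?_, ?_⟩
  · obtain ⟨ht, hht⟩ := h.rank
    exact ⟨ht, fun u v hv => hht u v (mem_cutLists_some hv)⟩
  · rintro (_ | u) v hv
    · rw [cutLists, Function.update_self] at hv
      rcases List.mem_cons.1 hv with rfl | hv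
      · exact h.mem _ _ hx
      · exact h.mem _ _ hv
    · exact h.mem _ _ (mem_cutLists_some hv)
  · exact fun u v hv => h.mem_parent u v (mem_cutLists_some hv)
  · intro v hv
    by_cases hvy : v = y
    · subst hvy
      simp [cutLists, h.degree v hv, List.length_erase_of_mem hx]
    · simp [cutLists, hvy, h.degree v hv]
  · intro u
    have h1 : Fit (a.bound w) (cutLists K x y (some u)) := by
      rw [cutLists, Function.update_of_ne (by simp)]
      by_cases hu : u = y
      · subst hu
        rw [Function.update_self]
        obtain ⟨l₁, l₂, hK⟩ := List.append_of_mem hx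
        have hx1 : x ∉ l₁ := fun h => by
          have hnd := hl.nodup (some u)
          simp [hK, List.nodup_append] at hnd
          grind
        have h2 := h.fit u
        rw [hK] at h2 ⊢
        rw [List.erase_append_right _ hx1, List.erase_cons_head]
        exact h2.erase
      · rw [Function.update_of_ne (by simpa using hu)]
        exact h.fit u
    refine h1.mono fun c hc => ?_
    have hcx := hne u c hc
    have hwc : w ≠ some c := by
      rcases hw with rfl | rfl
      · simp
      · simpa using hcx.symm
    by_cases hcy : c = y
    · subst hcy
      simp only [Aux.bound, Function.update_self, Function.update_of_ne hcx, hwc, if_false, if_true]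
      omega
    · simp [Aux.bound, hcx, hcy, hwc]

theorem Forest.mono_bound {w' : Option (Node Q A)} {μ : Node Q A → Bool} (h : Forest H K a w)
    (hb : ∀ u, ∀ c ∈ K (some u), a.bound w c ≤ Aux.bound { a with mark := μ } w' c) :
    Forest H K { a with mark := μ } w' :=
  ⟨h.rank, h.mem, h.mem_parent, h.degree, fun u => (h.fit u).mono (hb u)⟩

/-- If `y` is a root, the exception is void. If `y` is unmarked, the new mark replaces it. Otherwise
`y` is cut, and the exception passes to its parent. Such a round takes 17 steps and gains a root,
but loses a mark and hence 52 units of potential, so it costs nothing. The last round takes at most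
3 steps and may create a mark, which gives 55. -/
theorem wp_cascadingCut {y : Node Q A} (h : Holds m H K a) (hf : Forest H K a (some y))
    (hl : ∀ v ∈ H, ∃ p, v ∈ K p) (hy : y ∈ H) :
    wp (cascadingCut y) m k fun _ m' k' => ∃ K' d μ, Holds m' H K' { a with degree := d, mark := μ } ∧
      Forest H K' { a with degree := d, mark := μ } none ∧ (∀ v ∈ H, ∃ p, v ∈ K' p) ∧
      (∀ u, ∀ v ∈ K' (some u), v ∈ K (some u)) ∧ (∀ v ∈ K none, v ∈ K' none) ∧
      k' + potential H K' { a with degree := d, mark := μ } ≤ k + potential H K a + 55 := by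
  induction hn : marks H a.mark using Nat.strong_induction_on generalizing m k K a y with
  | _ n ih =>
  obtain ⟨p, hp⟩ := hl y hy
  have hpar : m (.parent y) = p := h.links.parent p y hp
  rw [cascadingCut]
  simp only [wp_bind, wp_read, hpar]
  rcases p with _ | z
  · simp only [wp_pure]
    refine ⟨K, a.degree, a.mark, h, hf.mono_bound ?_, hl, fun _ _ h => h, fun _ h => h,
      by simp only [potential]; omega⟩
    intro u c hc
    have : y ≠ c := by
      rintro rfl
      cases h.links.unique hp hc
    simp [Aux.bound, this]
  · simp only [wp_bind, wp_read, h.mark]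
    cases hm : a.mark y with
    | false =>
      simp only [wp_write]
      refine ⟨K, a.degree, Function.update a.mark y true, h.of_eq (by simp) (by simp [h.aux]),
        hf.mono_bound ?_, hl, fun _ _ h => h, fun _ h => h, ?_⟩
      · intro u c hc
        by_cases hcy : c = y
        · subst hcy; simp [Aux.bound, hm]
        · have : y ≠ c := fun h => hcy h.symm
          simp [Aux.bound, hcy, this]
      · have := marks_update_true_le (H := H) a.mark y
        simp only [potential]
        omega
    | true =>
      simp only [wp_bind]
      refine (wp_cut h hp).mono ?_
      rintro _ m1 k1 ⟨hk1, h1⟩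
      have hmarks := marks_update_false a.mark hy hm
      refine (ih (marks H (Function.update a.mark y false)) (by omega) h1
        (hf.cut h.links hp (.inr rfl)) (fun v hv => ?_) (hf.mem_parent z y hp) rfl).mono ?_
      · obtain ⟨q, hq⟩ := hl v hv
        exact mem_cutLists hq
      · rintro _ m2 k2 ⟨K2, d2, μ2, h2, hf2, hl2, hsub, hroot, hk2⟩
        refine ⟨K2, d2, μ2, h2, hf2, hl2, fun u v hv => mem_cutLists_some (hsub u v hv),
          fun v hv => hroot v (by simp [cutLists, hv]), ?_⟩
        simp only [potential, cutLists, Function.update_self, List.length_cons] at hk2 ⊢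
        omega

/-- The delicate case is that `v` stays below its parent: `updateMin v` must then not select `v`. It
does not, since some root has a key at most that of the parent, hence at most the new key of `v`. -/
theorem wp_decreaseKey {v : Node Q A} {c : ℝ≥0∞} (h : Holds m H K a) (hh : IsHeap H K a)
    (hv : v ∈ H) (hc : c ≤ a.dist v) :
    wp (decreaseKey v c) m k fun _ m' k' => ∃ K' a', Holds m' H K' a' ∧ IsHeap H K' a' ∧
      a'.status = a.status ∧ a'.pred = a.pred ∧
      k' + potential H K' a' ≤ k + potential H K a + 110 := by
  have hf := hh.forest
  set a1 : Aux Q A := { a with dist := Function.update a.dist v c } with ha1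
  have h1 : Holds (Function.update m (.dist v) c) H K a1 :=
    h.of_eq (by simp) (by simp [h.aux, ha1])
  have hf1 : Forest H K a1 none := ⟨hf.rank, hf.mem, hf.mem_parent, hf.degree, hf.fit⟩
  -- Only the arc that ends in `v` can violate the order, and it is cut in that case.
  have ho1 : ∀ u, ∀ x ∈ K (some u), x ≠ v → a1.dist u ≤ a1.dist x := by
    intro u x hx hxv
    have := hh.ordered u x hx
    by_cases hu : u = v
    · subst hu
      simpa [ha1, hxv] using hc.trans this
    · simpa [ha1, hxv, hu] using this
  have hle1 : ∀ u, a1.dist u ≤ a.dist u := by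
    intro u
    by_cases hu : u = v
    · subst hu; simpa [ha1] using hc
    · simp [ha1, hu]
  have hpot : potential H K a1 = potential H K a := rfl
  -- the final update of the pointer to the minimum
  have fin : ∀ m' k' K' d μ, Holds m' H K' { a1 with degree := d, mark := μ } →
      Forest H K' { a1 with degree := d, mark := μ } none → Ordered K' a1 →
      (∀ v ∈ H, ∃ p, v ∈ K' p) → (∀ x ∈ K none, x ∈ K' none) →
      (v ∈ K' none ∨ ∃ r, a.minRoot = some r ∧ a1.dist r ≤ a1.dist v) →
      k' + potential H K' { a1 with degree := d, mark := μ } ≤ k + potential H K a + 105 →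
      wp (updateMin v) m' k' fun _ m' k' => ∃ K' a', Holds m' H K' a' ∧ IsHeap H K' a' ∧
        a'.status = a.status ∧ a'.pred = a.pred ∧
        k' + potential H K' a' ≤ k + potential H K a + 110 := by
    intro m' k' K' d μ h' hf' ho' hl' hroot hv' hk'
    refine (wp_updateMin h' v).mono ?_
    rintro _ m2 k2 ⟨r, h2, hor, hrv, hru, hk2⟩
    refine ⟨K', _, h2, ⟨⟨hf'.rank, hf'.mem, hf'.mem_parent, hf'.degree, hf'.fit⟩, ho', hl', hh.slot,
      ?_, ?_⟩, rfl, rfl, ?_⟩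
    · intro r' hr'
      obtain rfl := Option.some.inj hr'
      rcases hor with h3 | ⟨rfl, h3⟩
      · exact hroot _ (hh.minRoot_mem _ h3)
      · rcases hv' with h4 | ⟨r', h4, h5⟩
        · exact h4
        · exact absurd (h3 r' h4) (not_lt.2 h5)
    · intro u hu
      refine ⟨r, rfl, ?_⟩
      by_cases huv : u = v
      · rw [huv]; exact hrv
      · obtain ⟨r', h3, h4⟩ := hh.minRoot_le u hu
        refine (hru r' h3).trans ((hle1 r').trans ?_)
        simpa [ha1, huv] using h4
    · simp only [potential] at hk' ⊢
      omega
  obtain ⟨p, hp⟩ := hh.listed v hv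
  have hpar : Function.update m (.dist v) c (.parent v) = p := h1.links.parent p v hp
  rw [decreaseKey]
  simp only [wp_bind, wp_write, wp_read, hpar]
  rcases p with _ | y
  · refine fin _ _ K a.degree a.mark h1 hf1 ?_ hh.listed (fun _ h => h) (.inl hp) ?_
    · intro u x hx
      refine ho1 u x hx ?_
      rintro rfl
      cases h.links.unique hp hx
    · simp only [potential]
      omega
  · have hyv : y ≠ v := by
      rintro rfl
      obtain ⟨ht, hht⟩ := hf.rank
      exact lt_irrefl _ (hht y y hp)
    have hky : Function.update m (.dist v) c (.dist y) = a1.dist y := h1.dist y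
    have hyH := hf.mem_parent y v hp
    simp only [wp_bind, wp_read, wp_compute]
    rw [hky]
    by_cases hlt : c < a1.dist y
    · simp only [hlt, decide_true, if_true, wp_bind]
      refine (wp_cut h1 hp).mono ?_
      rintro _ m2 k2 ⟨hk2, h2⟩
      refine (wp_cascadingCut h2 (hf1.cut h1.links hp (.inl rfl)) (fun x hx => ?_) hyH).mono ?_
      · obtain ⟨q, hq⟩ := hh.listed x hx
        exact mem_cutLists hq
      rintro _ m3 k3 ⟨K3, d3, μ3, h3, hf3, hl3, hsub, hroot, hk3⟩
      refine fin m3 k3 K3 d3 μ3 h3 hf3 ?_ hl3 ?_ (.inl (hroot v (by simp [cutLists]))) ?_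
      · intro u x hx
        have h4 := hsub u x hx
        refine ho1 u x (mem_cutLists_some h4) ?_
        rintro rfl
        exact absurd (h2.links.unique h4 (q := none) (by simp [cutLists])) (by simp)
      · exact fun x hx => hroot x (by simp [cutLists, hx])
      · have := marks_update_false_le (H := H) a.mark v
        simp only [potential, cutLists, Function.update_self, List.length_cons, ha1] at hk3 ⊢
        omega
    · simp only [hlt, decide_false, Bool.false_eq_true, if_false]
      refine fin _ _ K a.degree a.mark h1 hf1 ?_ hh.listed (fun _ h => h) (.inr ?_) ?_
      · intro u x hx
        by_cases hxv : x = v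
        · subst hxv
          obtain rfl := Option.some.inj (h.links.unique hp hx)
          simpa [ha1] using not_lt.1 hlt
        · exact ho1 u x hx hxv
      · obtain ⟨r, hr, hry⟩ := hh.minRoot_le y hyH
        refine ⟨r, hr, (hle1 r).trans (hry.trans ?_)⟩
        simpa [ha1, hyv] using not_lt.1 hlt
      · simp only [potential]
        omega

/-- The 40 consists of 14 steps and 26 units of potential for the new root. -/
theorem wp_insert {v : Node Q A} (h : Holds m H K a) (hh : IsHeap H K a) (hv : v ∉ H) :
    wp (insert v) m k fun _ m' k' => ∃ K' a', Holds m' (Insert.insert v H) K' a' ∧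
      IsHeap (Insert.insert v H) K' a' ∧ a'.status = a.status ∧ a'.pred = a.pred ∧
      k' + potential (Insert.insert v H) K' a' ≤ k + potential H K a + 40 := by
  have hf := hh.forest
  have hvK : ∀ p, v ∉ K p := fun p hp => hv (hf.mem p v hp)
  have hKv : K (some v) = [] := by
    rw [List.eq_nil_iff_forall_not_mem]
    exact fun u hu => hv (hf.mem_parent v u hu)
  rw [insert]
  simp only [wp_bind, wp_write]
  set a1 : Aux Q A := { a with
    degree := Function.update a.degree v 0, mark := Function.update a.mark v false } with ha1
  set m1 := Function.update (Function.update (Function.update m (.first (some v)) none)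
    (.degree v) 0) (.mark v) false with hm1
  have h1 : Holds m1 (Insert.insert v H) K a1 :=
    (h.insert hKv).of_eq (by simp [hm1]) (by simp [hm1, ha1, h.aux])
  have hne : ∀ u, ∀ c ∈ K (some u), c ≠ v := by
    rintro u c hc rfl
    exact hvK _ hc
  have hf1 : Forest (Insert.insert v H) K a1 none := by
    refine ⟨hf.rank, fun p u hu => Finset.mem_insert_of_mem (hf.mem p u hu),
      fun u x hx => Finset.mem_insert_of_mem (hf.mem_parent u x hx), ?_, ?_⟩
    · intro u hu
      by_cases huv : u = v
      · simp [ha1, huv, hKv]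
      · simpa [ha1, huv] using hf.degree u (Finset.mem_of_mem_insert_of_ne hu huv)
    · intro u
      refine (hf.fit u).mono fun c hc => ?_
      simp [Aux.bound, ha1, hne u c hc]
  refine (wp_push_updateMin h1 hvK ?_).mono fun _ m2 k2 h => h.mono ?_
  · refine ⟨fun u hu => ?_, hh.minRoot_mem⟩
    exact hh.minRoot_le u (hf.mem _ _ hu)
  rintro _ m3 k3 ⟨r, h3, hr, hk3⟩
  have hf3 : Forest (Insert.insert v H) (Function.update K none (v :: K none))
      { a1 with minRoot := r } none := by
    have : Forest (Insert.insert v H) K { a1 with minRoot := r } none :=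
      ⟨hf1.rank, hf1.mem, hf1.mem_parent, hf1.degree, hf1.fit⟩
    refine this.of_roots (by simp) fun u hu => ?_
    rw [Function.update_self] at hu
    rcases List.mem_cons.1 hu with rfl | hu
    · simp
    · exact hf1.mem _ _ hu
  have ho3 : Ordered (Function.update K none (v :: K none)) { a1 with minRoot := r } := by
    intro u x hx
    rw [Function.update_of_ne (by simp)] at hx
    exact hh.ordered u x hx
  have hl3 : ∀ u ∈ Insert.insert v H, ∃ p, u ∈ Function.update K none (v :: K none) p := by
    intro u hu
    rcases Finset.mem_insert.1 hu with rfl | hu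
    · exact ⟨none, by simp⟩
    · obtain ⟨_ | p, hp⟩ := hh.listed u hu
      · exact ⟨none, by simp [hp]⟩
      · exact ⟨some p, by simpa using hp⟩
  refine ⟨_, _, h3, ⟨hf3, ho3, hl3, hh.slot, hr.2, hf3.minRoot_le ho3 hl3 hr.1⟩, rfl, rfl, ?_⟩
  have hmarks : marks (Insert.insert v H) (Function.update a.mark v false) ≤ marks H a.mark := by
    refine Finset.card_le_card fun u hu => ?_
    rw [Finset.mem_filter] at hu ⊢
    by_cases huv : u = v
    · simp [huv] at hu
    · exact ⟨Finset.mem_of_mem_insert_of_ne hu.1 huv, by simpa [huv] using hu.2⟩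
  simp only [potential, Function.update_self, List.length_cons, ha1]
  omega

end DecreaseKey

/-! ### Dijkstra's algorithm -/

section Dijkstra

set_option linter.unusedSectionVars false

variable {Q A : Type} [FinEnum Q] [FinEnum A] {m : Region Q A} {k : ℕ}

/-- In the list `L` of states, the latest first, the predecessors of each state are older. -/
def Traceable (pred : Node Q A → Option (Q × A)) : List Q → Prop
  | [] => True
  | q :: l => (∀ q' x, pred (.inl q) = some (q', x) → q' ∈ l) ∧ Traceable pred l

theorem Traceable.congr {pred pred' : Node Q A → Option (Q × A)} {L : List Q}
    (h : Traceable pred L) (hp : ∀ q ∈ L, pred' (.inl q) = pred (.inl q)) : Traceable pred' L := by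
  induction L with
  | nil => trivial
  | cons q l ih =>
    refine ⟨?_, ih h.2 fun q' hq' => hp q' (by simp [hq'])⟩
    rw [hp q (by simp)]
    exact h.1

theorem Traceable.mem {pred : Node Q A → Option (Q × A)} {L : List Q}
    (h : Traceable pred L) {q q' : Q} {x : A} (hq : q ∈ L) (hp : pred (.inl q) = some (q', x)) :
    q' ∈ L := by
  induction L with
  | nil => simp at hq
  | cons q₀ l ih =>
    rcases List.mem_cons.1 hq with rfl | hq
    · exact List.mem_cons_of_mem _ (h.1 q' x hp)
    · exact List.mem_cons_of_mem _ (ih h.2 hq)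

/-- Every arc followed leads to an older settled state, so `L` bounds the length of the trace. No
property of distances enters. -/
theorem wp_traceBack {L : List Q} (h : Traceable (aux m).pred L) {v : Node Q A}
    (hv : ∀ q x, (aux m).pred v = some (q, x) → q ∈ L) (z : List (Q × A)) :
    wp (traceBack v z) m k fun _ m' k' => m' = m ∧ k' ≤ k + 2 * L.length + 1 := by
  induction L generalizing v z k with
  | nil =>
    rw [traceBack]
    simp only [wp_bind, wp_read]
    have hpv : m (.pred v) = (aux m).pred v := rfl
    rw [hpv]
    cases hp : (aux m).pred v with
    | none => exact wp_pure.2 ⟨rfl, by simp⟩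
    | some y => simpa using hv y.1 y.2 hp
  | cons q₀ l ih =>
    rw [traceBack]
    simp only [wp_bind, wp_read]
    have hpv : m (.pred v) = (aux m).pred v := rfl
    rw [hpv]
    cases hp : (aux m).pred v with
    | none => exact wp_pure.2 ⟨rfl, by omega⟩
    | some y =>
      obtain ⟨q, x⟩ := y
      simp only [wp_bind, wp_compute]
      refine (ih h.2 (v := .inl q) ?_ _).mono ?_
      · intro q' x' hq'
        rcases List.mem_cons.1 (hv q x hp) with rfl | hq
        · exact h.1 q' x' hq'
        · exact h.2.mem hq hq'
      · rintro _ m' k' ⟨rfl, hk'⟩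
        refine ⟨rfl, ?_⟩
        simp only [List.length_cons]
        omega

/-- The state of the search, where `L` lists the settled states of the machine, `S` is the set of
all settled nodes, and `φ` is the potential of the heap. -/
def Searching (m : Region Q A) (L : List Q) (S : Finset (Node Q A)) (φ : ℕ) : Prop :=
  (∀ q ∈ L, Sum.inl q ∈ S) ∧ L.Nodup ∧ ∃ H K a, Holds m H K a ∧ IsHeap H K a ∧
    (∀ v, v ∈ H ↔ a.status v = .queued) ∧ (∀ v, v ∈ S ↔ a.status v = .settled) ∧
    (∀ v q x, a.pred v = some (q, x) → q ∈ L) ∧ Traceable a.pred L ∧ potential H K a = φ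

/-- The worst case is `decreaseKey` with its 110 amortised steps, after 8 steps of preparation. -/
theorem wp_relax {L : List Q} {S : Finset (Node Q A)} {φ : ℕ} (h : Searching m L S φ) {q : Q}
    (hq : q ∈ L) (x : A) :
    wp (relax q x) m k fun _ m' k' => ∃ φ', Searching m' L S φ' ∧ k' + φ' ≤ k + φ + 130 := by
  obtain ⟨hLS, hnd, H, K, a, hm, hh, hqu, hse, hpr, htr, hφ⟩ := h
  rw [relax]
  simp only [wp_bind, wp_read]
  -- The bound holds for any contents of the tables, so target and cost of the arc are arbitrary.
  generalize m (.deltaHat q x) = v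
  have hst : m (.status v) = a.status v := hm.status v
  rw [hst]
  -- Only the predecessor of an unsettled node is changed, so the arcs between settled states remain
  -- traceable.
  have hpred : v ∉ S →
      (∀ u q' x', Function.update a.pred v (some (q, x)) u = some (q', x') → q' ∈ L) ∧
      Traceable (Function.update a.pred v (some (q, x))) L := by
    intro hv
    constructor
    · intro u q' x' hu
      by_cases huv : u = v
      · subst huv
        simp at hu
        rw [← hu.1]
        exact hq
      · rw [Function.update_of_ne huv] at hu
        exact hpr u q' x' hu
    · refine htr.congr fun q' hq' => ?_
      have : Sum.inl q' ≠ v := by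
        rintro rfl
        exact hv (hLS q' hq')
      rw [Function.update_of_ne this]
  have hsame : ∃ φ', Searching m L S φ' ∧ φ' = φ :=
    ⟨φ, ⟨hLS, hnd, H, K, a, hm, hh, hqu, hse, hpr, htr, hφ⟩, rfl⟩
  obtain ⟨φ', hsame, rfl⟩ := hsame
  cases hv : a.status v with
  | settled =>
    simp only [wp_pure]
    exact ⟨φ', hsame, by omega⟩
  | fresh =>
    simp only [wp_bind, wp_read, wp_compute]
    generalize m (.dist (.inl q)) + m (.gammaHat q x) = c
    have hvS : v ∉ S := by rw [hse, hv]; simp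
    have hvH : v ∉ H := by rw [hqu, hv]; simp
    split_ifs
    · simp only [wp_bind, wp_write]
      set a1 : Aux Q A := { a with
        dist := Function.update a.dist v c
        pred := Function.update a.pred v (some (q, x))
        status := Function.update a.status v .queued } with ha1
      have h1 : Holds (Function.update (Function.update (Function.update m (.dist v) c)
          (.pred v) (some (q, x))) (.status v) .queued) H K a1 :=
        hm.of_eq (by simp) (by simp [ha1, hm.aux])
      have hf := hh.forest
      -- The key is written before the node enters the heap, and the heap invariant sees only keys
      -- of nodes in `H`.
      have hdist : ∀ u ∈ H, a1.dist u = a.dist u := by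
        intro u hu
        have : u ≠ v := by rintro rfl; exact hvH hu
        simp [ha1, this]
      have hh1 : IsHeap H K a1 := by
        refine ⟨⟨hf.rank, hf.mem, hf.mem_parent, hf.degree, hf.fit⟩, ?_, hh.listed, hh.slot,
          hh.minRoot_mem, ?_⟩
        · intro u y hy
          rw [hdist _ (hf.mem_parent u y hy), hdist _ (hf.mem _ y hy)]
          exact hh.ordered u y hy
        · intro u hu
          obtain ⟨r, hr, hru⟩ := hh.minRoot_le u hu
          refine ⟨r, hr, ?_⟩
          rwa [hdist _ hu, hdist _ (hf.mem _ r (hh.minRoot_mem r hr))]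
      refine (wp_insert h1 hh1 hvH).mono ?_
      rintro _ m2 k2 ⟨K2, a2, h2, hh2, hs2, hp2, hk2⟩
      refine ⟨_, ⟨hLS, hnd, _, K2, a2, h2, hh2, ?_, ?_, ?_, ?_, rfl⟩, ?_⟩
      · intro u
        rw [hs2, Finset.mem_insert, hqu]
        by_cases huv : u = v
        · simp [ha1, huv]
        · simp [ha1, huv]
      · intro u
        rw [hs2, hse]
        by_cases huv : u = v
        · simp [ha1, huv, hv]
        · simp [ha1, huv]
      · rw [hp2]
        exact (hpred hvS).1
      · rw [hp2]
        exact (hpred hvS).2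
      · have : potential H K a1 = potential H K a := rfl
        omega
    · simp only [wp_pure]
      exact ⟨φ', hsame, by omega⟩
  | queued =>
    simp only [wp_bind, wp_read, wp_compute]
    generalize m (.dist (.inl q)) + m (.gammaHat q x) = c
    have hvS : v ∉ S := by rw [hse, hv]; simp
    have hvH : v ∈ H := by rw [hqu, hv]
    split_ifs with hlt
    · simp only [wp_bind, wp_write]
      have h1 : Holds (Function.update m (.pred v) (some (q, x))) H K
          { a with pred := Function.update a.pred v (some (q, x)) } :=
        hm.of_eq (by simp) (by simp [hm.aux])
      have hf := hh.forest
      have hh1 : IsHeap H K { a with pred := Function.update a.pred v (some (q, x)) } :=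
        ⟨⟨hf.rank, hf.mem, hf.mem_parent, hf.degree, hf.fit⟩, hh.ordered, hh.listed, hh.slot,
          hh.minRoot_mem, hh.minRoot_le⟩
      refine (wp_decreaseKey h1 hh1 hvH ?_).mono ?_
      · have := of_decide_eq_true hlt
        rw [hm.dist] at this
        exact this.le
      rintro _ m2 k2 ⟨K2, a2, h2, hh2, hs2, hp2, hk2⟩
      refine ⟨_, ⟨hLS, hnd, _, K2, a2, h2, hh2, ?_, ?_, ?_, ?_, rfl⟩, ?_⟩
      · rw [hs2]
        exact hqu
      · rw [hs2]
        exact hse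
      · rw [hp2]
        exact (hpred hvS).1
      · rw [hp2]
        exact (hpred hvS).2
      · have : potential H K { a with pred := Function.update a.pred v (some (q, x)) } =
          potential H K a := rfl
        omega
    · simp only [wp_pure]
      exact ⟨φ', hsame, by omega⟩

/-- The amortised number of steps of the round of the search that settles a node. -/
def nodeCost : Node Q A → ℕ
  | .inl _ => deleteCost Q A + 10 + 130 * FinEnum.card A
  | .inr _ => deleteCost Q A + 10

/-- Each round settles a new node, so the unsettled nodes provide both the termination measure and
the budget. The counter `exitsLeft` is not in the invariant, as it can only end the search early. -/
theorem wp_search {L : List Q} {S : Finset (Node Q A)} {φ : ℕ} (h : Searching m L S φ) :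
    wp search m k fun _ m' k' => ∃ L' S' φ', Searching m' L' S' φ' ∧
      k' ≤ k + φ + 3 + ∑ v ∈ Sᶜ, nodeCost v := by
  induction hn : Sᶜ.card using Nat.strong_induction_on generalizing m k L S φ with
  | _ n ih =>
  obtain ⟨hLS, hnd, H, K, a, hm, hh, hqu, hse, hpr, htr, hφ⟩ := id h
  have hdone : ∀ k' ≤ k + 3, ∃ L' S' φ', Searching m L' S' φ' ∧
      k' ≤ k + φ + 3 + ∑ v ∈ Sᶜ, nodeCost v := fun k' hk' => ⟨L, S, φ, h, by omega⟩
  rw [search]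
  simp only [wp_bind, wp_read, hm.minRoot]
  cases hr : a.minRoot with
  | none =>
    simp only [wp_pure]
    exact hdone _ (by omega)
  | some u =>
    simp only [wp_bind, wp_read, wp_compute]
    split_ifs
    · simp only [wp_pure]
      exact hdone _ (by omega)
    · have hu := hh.minRoot_mem u hr
      have huq := (hqu u).1 (hh.forest.mem _ u hu)
      have huS : u ∉ S := by rw [hse, huq]; simp
      simp only [wp_bind]
      refine (wp_deleteMin hm hh hu).mono ?_
      rintro _ m1 k1 ⟨K1, a1, h1, hh1, hd1, hs1, hp1, hk1⟩
      simp only [wp_write]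
      set a2 : Aux Q A := { a1 with status := Function.update a1.status u .settled } with ha2
      set m2 := Function.update m1 (.status u) Status.settled with hm2
      have h2 : Holds m2 (H.erase u) K1 a2 := h1.of_eq (by simp [hm2]) (by simp [hm2, ha2, h1.aux])
      have hf1 := hh1.forest
      have hh2 : IsHeap (H.erase u) K1 a2 :=
        ⟨⟨hf1.rank, hf1.mem, hf1.mem_parent, hf1.degree, hf1.fit⟩, hh1.ordered, hh1.listed,
          hh1.slot, hh1.minRoot_mem, hh1.minRoot_le⟩
      have hqu2 : ∀ v, v ∈ H.erase u ↔ a2.status v = .queued := by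
        intro v
        rw [Finset.mem_erase, hqu]
        by_cases hvu : v = u
        · simp [ha2, hvu]
        · simp [ha2, hvu, hs1]
      have hse2 : ∀ v, v ∈ Insert.insert u S ↔ a2.status v = .settled := by
        intro v
        rw [Finset.mem_insert, hse]
        by_cases hvu : v = u
        · simp [ha2, hvu]
        · simp [ha2, hvu, hs1]
      have hcompl : (Insert.insert u S)ᶜ = Sᶜ.erase u := by
        ext v
        simp
      have huS' : u ∈ Sᶜ := by simpa using huS
      have hcard : ((Insert.insert u S)ᶜ).card < n := by
        rw [← hn, hcompl]
        exact Finset.card_erase_lt_of_mem huS'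
      have hsum : nodeCost u + ∑ v ∈ (Insert.insert u S)ᶜ, nodeCost v = ∑ v ∈ Sᶜ, nodeCost v := by
        rw [hcompl]
        exact Finset.add_sum_erase _ _ huS'
      have hpot : potential (H.erase u) K1 a2 = potential (H.erase u) K1 a1 := rfl
      have hp2 : a2.pred = a.pred := hp1
      rcases u with q | x
      · have hqL : q ∉ L := fun hq => huS (hLS q hq)
        have hS2 : Searching m2 (q :: L) (Insert.insert (Sum.inl q) S)
            (potential (H.erase (Sum.inl q)) K1 a2) := by
          refine ⟨?_, List.nodup_cons.2 ⟨hqL, hnd⟩, _, K1, a2, h2, hh2, hqu2, hse2, ?_, ?_, rfl⟩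
          · intro q' hq'
            rcases List.mem_cons.1 hq' with rfl | hq'
            · simp
            · exact Finset.mem_insert_of_mem (hLS q' hq')
          · intro v q' x' hv
            rw [hp2] at hv
            exact List.mem_cons_of_mem _ (hpr v q' x' hv)
          · rw [hp2]
            exact ⟨hpr _, htr⟩
        simp only [wp_bind]
        refine (wp_forM (fun rest m' k' => ∃ φ',
          Searching m' (q :: L) (Insert.insert (Sum.inl q) S) φ' ∧
          k' + φ' + 130 * rest.length ≤
            k + φ + deleteCost Q A + 4 + 130 * FinEnum.card A) ?_ ?_).mono ?_
        · refine ⟨_, hS2, ?_⟩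
          rw [length_toList]
          omega
        · rintro x l m3 k3 ⟨φ3, h3, hk3⟩
          refine (wp_relax h3 (by simp) x).mono ?_
          rintro _ m4 k4 ⟨φ4, h4, hk4⟩
          refine ⟨φ4, h4, ?_⟩
          simp only [List.length_cons] at hk3
          omega
        · rintro _ m3 k3 ⟨φ3, h3, hk3⟩
          refine (ih _ hcard h3 rfl).mono ?_
          rintro _ m4 k4 ⟨L4, S4, φ4, h4, hk4⟩
          refine ⟨L4, S4, φ4, h4, ?_⟩
          simp only [List.length_nil, nodeCost] at hk3 hsum
          simp only [nodeCost] at hk4 ⊢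
          omega
      · simp only [wp_bind, wp_compute, wp_write]
        refine (ih _ hcard (L := L) (φ := potential (H.erase (Sum.inr x)) K1 a2) ?_ rfl).mono ?_
        · refine ⟨fun q hq => Finset.mem_insert_of_mem (hLS q hq), hnd, _, K1, a2,
            h2.of_eq (by simp) (by simp [h2.aux]), hh2, hqu2, hse2, ?_, ?_, rfl⟩
          · rw [hp2]
            exact hpr
          · rw [hp2]
            exact htr
        · rintro _ m4 k4 ⟨L4, S4, φ4, h4, hk4⟩
          refine ⟨L4, S4, φ4, h4, ?_⟩
          have hc : nodeCost (Sum.inr x : Node Q A) = deleteCost Q A + 10 := rfl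
          omega

/-- This is all that an empty heap requires: the pointers of individual nodes and the initial
distances play no role in the analysis. -/
theorem wp_initSearch : wp (initSearch (Q := Q) (A := A)) m k fun _ m' k' =>
    m' (.first none) = none ∧ (aux m').minRoot = none ∧
      (∀ d ≤ FinEnum.card (Node Q A), (aux m').slot d = none) ∧
      (∀ v, (aux m').status v = .fresh) ∧ (∀ v, (aux m').pred v = none) ∧
      k' ≤ k + 4 * FinEnum.card (Node Q A) + 4 := by
  rw [initSearch, wp_bind]
  refine (wp_forM (fun rest m' k' => (∀ v, v ∉ rest → (aux m').status v = .fresh) ∧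
    (∀ v, v ∉ rest → (aux m').pred v = none) ∧
    k' + 3 * rest.length ≤ k + 3 * FinEnum.card (Node Q A)) ?_ ?_).mono ?_
  · refine ⟨fun v hv => absurd (FinEnum.mem_toList v) hv,
      fun v hv => absurd (FinEnum.mem_toList v) hv, ?_⟩
    rw [length_toList]
  · rintro v l m1 k1 ⟨h1, h2, hk1⟩
    simp only [wp_bind, wp_write]
    simp only [List.length_cons] at hk1
    refine ⟨fun u hu => ?_, fun u hu => ?_, by omega⟩
    · by_cases huv : u = v
      · simp [huv]
      · simpa [huv] using h1 u (by simp [huv, hu])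
    · by_cases huv : u = v
      · simp [huv]
      · simpa [huv] using h2 u (by simp [huv, hu])
  rintro _ m1 k1 ⟨h1, h2, hk1⟩
  rw [wp_bind]
  refine (wp_forM_range (fun i m' k' => (∀ d < i, (aux m').slot d = none) ∧
    (∀ v, (aux m').status v = .fresh) ∧ (∀ v, (aux m').pred v = none) ∧ k' ≤ k1 + i) ?_ ?_).mono ?_
  · exact ⟨by simp, fun v => h1 v (by simp), fun v => h2 v (by simp), by omega⟩
  · rintro i m2 k2 hi ⟨h3, h4, h5, hk2⟩
    simp only [wp_write]
    refine ⟨fun d hd => ?_, by simpa using h4, by simpa using h5, by omega⟩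
    by_cases hdi : d = i
    · simp [hdi]
    · simpa [hdi] using h3 d (by omega)
  rintro _ m2 k2 ⟨h3, h4, h5, hk2⟩
  simp only [wp_bind, wp_write]
  simp only [List.length_nil] at hk1
  refine ⟨by simp, by simp, ?_, by simpa using h4, by simpa using h5, by omega⟩
  intro d hd
  simpa using h3 d (by omega)

/-- A bound for the number of steps of Dijkstra's algorithm. -/
def dijkstraCost (q s : ℕ) : ℕ :=
  (q + s) * (80 * (degBound (q + s) + 1) + 14) + 132 * (q * s) + 5 * s + 60

theorem card_node : FinEnum.card (Node Q A) = FinEnum.card Q + FinEnum.card A := by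
  rw [FinEnum.card_eq_fintypeCard, FinEnum.card_eq_fintypeCard, FinEnum.card_eq_fintypeCard,
    ← Fintype.card_sum]

theorem sum_nodeCost : ∑ v : Node Q A, nodeCost v =
    (FinEnum.card Q + FinEnum.card A) *
        (80 * (degBound (FinEnum.card Q + FinEnum.card A) + 1) + 10) +
      130 * (FinEnum.card Q * FinEnum.card A) := by
  have h1 : ∑ v : Node Q A, nodeCost v = ∑ q : Q, nodeCost (.inl q : Node Q A) +
      ∑ x : A, nodeCost (.inr x : Node Q A) := by
    rw [← Fintype.sum_sum_type]
  rw [h1]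
  simp only [nodeCost, deleteCost, Finset.sum_const, Finset.card_univ, smul_eq_mul, card_node,
    ← FinEnum.card_eq_fintypeCard]
  ring

theorem wp_dijkstra (s : Q) : wp (dijkstra (A := A) s) m k fun _ _ k' =>
    k' ≤ k + dijkstraCost (FinEnum.card Q) (FinEnum.card A) := by
  rw [dijkstra, wp_bind]
  refine wp_initSearch.mono ?_
  rintro _ m1 k1 ⟨hfirst, hmin, hslot, hstatus, hpred, hk1⟩
  simp only [wp_bind, wp_write]
  set m2 := Function.update (Function.update m1 (.dist (.inl s)) 0)
    (.status (.inl s)) Status.queued with hm2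
  have h2 : Holds m2 ∅ (fun _ => []) (aux m2) := by
    refine ⟨⟨?_, by simp, by simp, by simp, by simp⟩, rfl⟩
    simpa [hm2, ptr] using hfirst
  have hh2 : IsHeap ∅ (fun _ => []) (aux m2) := by
    refine ⟨⟨⟨fun _ => 0, by simp⟩, by simp, by simp, by simp, fun _ => trivial⟩, ?_, by simp, ?_, ?_,
      by simp⟩
    · intro u v hv
      simp at hv
    · simpa [hm2] using hslot
    · simp [hm2, hmin]
  refine (wp_insert h2 hh2 (v := .inl s) (by simp)).mono ?_
  rintro _ m3 k3 ⟨K3, a3, h3, hh3, hs3, hp3, hk3⟩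
  have hpot : potential ∅ (fun _ => []) (aux m2) = 0 := by simp [potential, marks]
  have hsearch : Searching m3 [] ∅ (potential (Insert.insert (.inl s) ∅) K3 a3) := by
    refine ⟨by simp, List.nodup_nil, _, K3, a3, h3, hh3, ?_, ?_, ?_, trivial, rfl⟩
    · intro v
      rw [hs3]
      by_cases hvs : v = .inl s
      · simp [hvs, hm2]
      · simp [hvs, hm2, hstatus]
    · intro v
      rw [hs3]
      by_cases hvs : v = .inl s
      · simp [hvs, hm2]
      · simp [hvs, hm2, hstatus]
    · intro v q x hv
      rw [hp3] at hv
      simp [hm2, hpred] at hv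
  refine (wp_search hsearch).mono ?_
  rintro _ m4 k4 ⟨L, S, φ, ⟨hLS, hnd, H, K4, a4, h4, -, -, -, hpr, htr, -⟩, hk4⟩
  -- Settled states are listed without repetition, so a trace has at most one arc per state after
  -- its first arc.
  have hL : L.length ≤ FinEnum.card Q := by
    rw [FinEnum.card_eq_fintypeCard]
    exact hnd.length_le_card
  refine (wp_forM (fun rest m' k' => aux m' = a4 ∧
    k' + (2 * FinEnum.card Q + 4) * rest.length ≤
      k4 + (2 * FinEnum.card Q + 4) * FinEnum.card A) ?_ ?_).mono ?_
  · rw [length_toList]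
    exact ⟨h4.aux, le_rfl⟩
  · rintro x l m5 k5 ⟨h5, hk5⟩
    simp only [wp_bind, wp_read, wp_write]
    refine (wp_traceBack (L := L) ?_ ?_ []).mono ?_
    · simpa [h5] using htr
    · simpa [h5] using hpr (E x)
    · rintro z m6 k6 ⟨rfl, hk6⟩
      refine ⟨by simp [h5], ?_⟩
      rw [List.length_cons, Nat.mul_succ] at hk5
      omega
  · rintro _ m5 k5 ⟨h5, hk5⟩
    rw [Finset.compl_empty, sum_nodeCost] at hk4
    rw [card_node] at hk1
    simp only [List.length_nil, mul_zero] at hk5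
    unfold dijkstraCost
    generalize degBound (FinEnum.card Q + FinEnum.card A) = D at *
    generalize FinEnum.card Q = q at *
    generalize FinEnum.card A = s at *
    -- Initialisation adds 4 steps per node to the 10 of `nodeCost`. Tracing adds 2 steps per state
    -- and exit to the 130 per arc, and 4 more per exit.
    have e1 : (q + s) * (80 * (D + 1) + 14) = (q + s) * (80 * (D + 1) + 10) + 4 * (q + s) := by ring
    have e2 : (2 * q + 4) * s = 2 * (q * s) + 4 * s := by ring
    omega

end Dijkstra

/-! ### The offline step -/

theorem wp_constructAugmented {A : Type} [FinEnum A] (M : MealyMachine A) {m : Region M.Q A}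
    {k : ℕ} : wp (constructAugmented M) m k fun _ _ k' =>
      k' ≤ k + 6 * (FinEnum.card M.Q * FinEnum.card A) := by
  rw [constructAugmented]
  refine (wp_forM (fun rest m' k' => k' + 6 * (rest.length * FinEnum.card A) ≤
    k + 6 * (FinEnum.card M.Q * FinEnum.card A)) ?_ ?_).mono ?_
  · rw [length_toList]
  · intro q l m1 k1 h1
    refine (wp_forM (fun rest m' k' => k' + 6 * rest.length ≤ k1 + 6 * FinEnum.card A) ?_ ?_).mono ?_
    · rw [length_toList]
    · intro x l' m2 k2 h2
      simp only [List.length_cons] at h2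
      simp only [wp_bind, wp_read, wp_compute]
      cases M.δ q x with
      | none => simp only [wp_bind, wp_write]; omega
      | some q' => simp only [wp_bind, wp_compute, wp_write]; omega
    · intro _ m2 k2 h2
      simp only [List.length_nil] at h2
      rw [List.length_cons, add_one_mul] at h1
      omega
  · intro _ m1 k1 h1
    simpa using h1

namespace Hierarchy

variable {A : Type} (Z : Hierarchy A)

/-- The relation of parents to children. -/
def Arc (M M' : Z.X) : Prop := ∃ q, Z.child M q = some M'

theorem arc_unique (M₁ M₂ M' : Z.X) (h₁ : Z.Arc M₁ M') (h₂ : Z.Arc M₂ M') : M₁ = M₂ := by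
  obtain ⟨q₁, h₁⟩ := h₁
  obtain ⟨q₂, h₂⟩ := h₂
  exact congrArg Sigma.fst (Z.parent_unique M' ⟨M₁, q₁⟩ ⟨M₂, q₂⟩ h₁ h₂)

/-- No arc enters the root. If a cycle passes through another machine, it also passes through its
unique parent, and so back along the path to the root. -/
theorem arc_acyclic (M : Z.X) : ¬ Relation.TransGen Z.Arc M M := by
  have h := Z.reachable M
  induction h with
  | refl =>
    intro h
    obtain ⟨M', -, q, hq⟩ := Relation.TransGen.tail'_iff.1 h
    exact Z.root_no_parent _ _ hq
  | @tail M₁ M₂ _ h₂ ih =>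
    intro h
    obtain ⟨M', h₃, h₄⟩ := Relation.TransGen.tail'_iff.1 h
    obtain rfl := Z.arc_unique _ _ _ h₄ h₂
    exact ih (Relation.TransGen.head' h₂ h₃)

end Hierarchy

/-- A bound for the number of steps that are made for one machine. -/
def machineCost (q s : ℕ) : ℕ := q + 8 * (q * s) + dijkstraCost q s

section OfflineStep

variable {A : Type} [FinEnum A] (Z : Hierarchy A)

/-- A bound for the number of steps of the recursive procedure. -/
def subtreeCost (M : Z.X) : ℕ :=
  ∑ Y ∈ descendants Z.Arc M, machineCost (FinEnum.card (Z.machine Y).Q) (FinEnum.card A)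

/-- Distinct states lead to distinct machines, so no subtree is counted twice. -/
theorem machineCost_add_le_subtreeCost (M : Z.X) :
    machineCost (FinEnum.card (Z.machine M).Q) (FinEnum.card A) +
      (((FinEnum.toList (Z.machine M).Q).filterMap (Z.child M)).map (subtreeCost Z)).sum ≤
      subtreeCost Z M := by
  have hnd : ((FinEnum.toList (Z.machine M).Q).filterMap (Z.child M)).Nodup := by
    refine FinEnum.nodup_toList.filterMap ?_
    intro q q' M' h h'
    have := Z.parent_unique M' ⟨M, q⟩ ⟨M, q'⟩ h h'
    simpa using this
  rw [← List.sum_toFinset _ hnd]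
  refine sum_descendants_le Z.arc_unique Z.arc_acyclic
    (fun Y => machineCost (FinEnum.card (Z.machine Y).Q) (FinEnum.card A)) ?_
  intro M' hM'
  rw [List.mem_toFinset, List.mem_filterMap] at hM'
  obtain ⟨q, -, hq⟩ := hM'
  exact ⟨q, hq⟩

theorem wp_optimalExit (M : Z.X) {m : Store Z} {k : ℕ} :
    wp (optimalExit Z M) m k fun _ _ k' => k' ≤ k + subtreeCost Z M := by
  induction hn : (descendants Z.Arc M).card using Nat.strong_induction_on generalizing M m k with
  | _ n ih =>
  have hcost := machineCost_add_le_subtreeCost Z M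
  rw [optimalExit, wp_bind]
  -- The invariant reserves for each remaining state 1 step for the look-up, 2 per input for its
  -- exit costs, and the cost of its subtree.
  refine (wp_forM (fun rest m' k' => k' + (rest.length + 2 * (rest.length * FinEnum.card A)) +
    ((rest.filterMap (Z.child M)).map (subtreeCost Z)).sum ≤
      k + (FinEnum.card (Z.machine M).Q + 2 * (FinEnum.card (Z.machine M).Q * FinEnum.card A)) +
    (((FinEnum.toList (Z.machine M).Q).filterMap (Z.child M)).map (subtreeCost Z)).sum)
    ?_ ?_).mono ?_
  · rw [length_toList]
  · intro q l m1 k1 h1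
    rw [List.length_cons, add_one_mul] at h1
    simp only [wp_bind, wp_compute]
    cases hq : Z.child M q with
    | none =>
      rw [List.filterMap_cons_none hq] at h1
      refine (wp_forM (fun rest m' k' => k' + 2 * rest.length ≤ k1 + 1 + 2 * FinEnum.card A)
        ?_ ?_).mono ?_
      · rw [length_toList]
      · intro x l' m2 k2 h2
        simp only [List.length_cons] at h2
        refine wp_inRegion (wp_write.2 ?_)
        omega
      · intro _ m2 k2 h2
        simp only [List.length_nil] at h2
        omega
    | some M' =>
      rw [List.filterMap_cons_some hq, List.map_cons, List.sum_cons] at h1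
      -- The subtree of a child omits `M`, which makes the recursion terminate.
      have hlt : (descendants Z.Arc M').card < n := by
        have := sum_descendants_le Z.arc_unique Z.arc_acyclic (fun _ => 1) (u := M) (s := {M'})
          (by simpa using ⟨q, hq⟩)
        simp at this
        omega
      simp only [wp_bind]
      refine (ih _ hlt M' rfl).mono ?_
      intro _ m2 k2 h2
      refine (wp_forM (fun rest m' k' => k' + 2 * rest.length ≤ k2 + 2 * FinEnum.card A)
        ?_ ?_).mono ?_
      · rw [length_toList]
      · intro x l' m3 k3 h3
        simp only [List.length_cons] at h3
        refine wp_bind.2 (wp_inRegion (wp_read.2 (wp_inRegion (wp_write.2 ?_))))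
        omega
      · intro _ m3 k3 h3
        simp only [List.length_nil] at h3
        omega
  · intro _ m1 k1 h1
    simp only [List.length_nil, List.filterMap_nil, List.map_nil, List.sum_nil] at h1
    rw [wp_bind]
    refine wp_inRegion ((wp_constructAugmented _).mono fun _ m2 k2 h2 => ?_)
    refine wp_inRegion ((wp_dijkstra _).mono fun _ m3 k3 h3 => ?_)
    unfold machineCost at hcost
    omega

end OfflineStep

/-! ### Estimates for the cost bounds -/

theorem dijkstraCost_mono {q q' : ℕ} (s : ℕ) (h : q ≤ q') : dijkstraCost q s ≤ dijkstraCost q' s := by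
  have h1 : degBound (q + s) ≤ degBound (q' + s) := by
    have : Nat.log 2 (q + s) ≤ Nat.log 2 (q' + s) := Nat.log_mono_right (by omega)
    unfold degBound
    omega
  unfold dijkstraCost
  gcongr

theorem machineCost_mono {q q' : ℕ} (s : ℕ) (h : q ≤ q') : machineCost q s ≤ machineCost q' s := by
  have := dijkstraCost_mono s h
  unfold machineCost
  gcongr

theorem machineCost_le {q s : ℕ} (hq : 1 ≤ q) (hs : 1 ≤ s) :
    (machineCost q s : ℝ) ≤ 700 * ((q : ℝ) * s + ((q : ℝ) + s) * Real.log ((q : ℝ) + s)) := by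
  have hq' : (1 : ℝ) ≤ q := by exact_mod_cast hq
  have hs' : (1 : ℝ) ≤ s := by exact_mod_cast hs
  have hlog2 : (0.69 : ℝ) < Real.log 2 := by
    have := Real.log_two_gt_d9
    norm_num at this ⊢
    linarith
  set n : ℝ := (q : ℝ) + s with hn
  have hlog : Real.log 2 ≤ Real.log n := Real.log_le_log (by norm_num) (by linarith)
  -- Since log 2 > 1/2, the factor 2 covers the change of base. As n ≥ 2, the same inequality
  -- absorbs the linear terms into n log n.
  have hD : (Nat.log 2 (q + s) : ℝ) ≤ 2 * Real.log n := by
    have h1 := Real.natLog_le_logb (q + s) 2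
    rw [Real.logb] at h1
    push_cast at h1
    refine h1.trans ?_
    rw [div_le_iff₀ (by linarith)]
    nlinarith
  have h1 : n * (Nat.log 2 (q + s) : ℝ) ≤ n * (2 * Real.log n) :=
    mul_le_mul_of_nonneg_left hD (by linarith)
  have h2 : n * 1 ≤ n * (2 * Real.log n) := mul_le_mul_of_nonneg_left (by linarith) (by linarith)
  have h3 : (q : ℝ) ≤ q * s := by nlinarith
  have h4 : (s : ℝ) ≤ q * s := by nlinarith
  unfold machineCost dijkstraCost degBound
  push_cast
  rw [← hn]
  nlinarith

end HiMM

end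

theorem proposition2 :
    ∃ C : ℝ, ∀ (A : Type) [FinEnum A] [Nonempty A] (Z : HiMM.Hierarchy A) (m₀ : HiMM.Store Z),
      ∃ (m : HiMM.Store Z) (t : ℕ),
        HiMM.offlineStep Z ⟨m₀, 0⟩ = some ((), ⟨m, t⟩) ∧
        (t : ℝ) ≤ C * ((Z.numMachines : ℝ) *
          ((Z.maxStates : ℝ) * (FinEnum.card A : ℝ) +
            ((Z.maxStates : ℝ) + (FinEnum.card A : ℝ)) *
              Real.log ((Z.maxStates : ℝ) + (FinEnum.card A : ℝ)))) := by
  refine ⟨700, fun A _ _ Z m₀ => ?_⟩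
  obtain ⟨⟨⟩, m, t, h, ht⟩ := HiMM.wp_optimalExit Z Z.root (m := m₀) (k := 0)
  refine ⟨m, t, h, ?_⟩
  -- The descendants of the root are at most N machines, each of which costs at most as much as one
  -- with the maximal number of states.
  have hcost : HiMM.subtreeCost Z Z.root ≤
      Z.numMachines * HiMM.machineCost Z.maxStates (FinEnum.card A) := by
    refine (Finset.sum_le_card_nsmul _ _ (HiMM.machineCost Z.maxStates (FinEnum.card A)) ?_).trans ?_
    · intro Y _
      exact HiMM.machineCost_mono _ (Finset.le_sup (f := fun M : Z.X => FinEnum.card (Z.machine M).Q)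
        (Finset.mem_univ Y))
    · rw [smul_eq_mul]
      exact Nat.mul_le_mul_right _ (Finset.card_le_univ _)
  -- The start state of the root machine ensures this; with a nonempty alphabet it makes the
  -- argument of the logarithm at least 2.
  have hq : 1 ≤ Z.maxStates := by
    have : Nonempty (Z.machine Z.root).Q := ⟨(Z.machine Z.root).start⟩
    exact le_trans (FinEnum.card_pos (α := (Z.machine Z.root).Q))
      (Finset.le_sup (f := fun M : Z.X => FinEnum.card (Z.machine M).Q) (Finset.mem_univ Z.root))
  have ht' : (t : ℝ) ≤ Z.numMachines * HiMM.machineCost Z.maxStates (FinEnum.card A) := by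
    have : t ≤ Z.numMachines * HiMM.machineCost Z.maxStates (FinEnum.card A) := by omega
    exact_mod_cast this
  refine ht'.trans ?_
  rw [mul_left_comm]
  exact mul_le_mul_of_nonneg_left (HiMM.machineCost_le hq FinEnum.card_pos) (by positivity)
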